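/- **Proposition (reduction of $\overline H$ to Schrödinger form).** *Setting.* Let $N$ be the number of particles, $a\in\mathbb R$, $m\in\{0,1,2,\dots\}$, and let $c_{++},c_{0+},c_{00},c_{0-},c_{--},c_+,c_0,c_-$ be arbitrary real constants. Let $\mathfrak S=\operatorname{span}_{\mathbb C}\{|s_1,\dots,s_N\rangle : s_i=-M,-M+1,\dots,M\}$ with $M\in\frac12\mathbb N$. Let $S_{ij}$ exchange $s_i$ and $s_j$, and let $K_{ij}$ exchange $z_i$ and $z_j$ in functions of $\mathbf z\in\mathbb R^N$. Define the Dunkl operators $$J_i^-=\partial_{z_i}+a\sum_{j\ne i}\frac{1}{z_i-z_j}(1-K_{ij}),\qquad J_i^0=z_i\partial_{z_i}-\frac m2+\frac a2\sum_{j\ne i}\frac{z_i+z_j}{z_i-z_j}(1-K_{ij}),$$ $$J_i^+=z_i^2\partial_{z_i}-mz_i+a\sum_{j\ne i}\frac{z_iz_j}{z_i-z_j}(1-K_{ij}),$$ and let $$-H^*=\sum_i\Big(c_{++}(J_i^+)^2+c_{00}(J_i^0)^2+c_{--}(J_i^-)^2+\tfrac{c_{0+}}2\{J_i^0,J_i^+\}+\tfrac{c_{0-}}2\{J_i^0,J_i^-\}+c_+J_i^++c_0J_i^0+c_-J_i^-\Big).$$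 Put $b=1+m+a(N-1)$, $P(z)=c_{++}z^4+c_{0+}z^3+c_{00}z^2+c_{0-}z+c_{--}$, $Q(z)=c_+z^2+c_0z+c_-$, $\tilde Q=Q+(1-\frac b2)P'$ and $$R(z)=c_{++}\big(b+m(m-2)-1\big)z^2+\Big[c_{0+}\big((1-\tfrac m2)b+m(m-1)-1\big)-mc_+\Big]z+\frac{c_{00}}4\big(2(b-1)+m(m-2)\big)-\frac m2c_0 .$$ Write $\sum'_{i,j,k}$ for the sum over pairwise distinct $i,j,k$. The gauge spin Hamiltonian $\overline H$ is the matrix differential operator $$\begin{aligned}-\overline H={}&\sum_i\big(P(z_i)\partial_{z_i}^2+\tilde Q(z_i)\partial_{z_i}+R(z_i)\big)+2ac_{++}(1-m)\sum_{i<j}z_iz_j\\&+2a\sum_{i<j}\frac{1}{z_i-z_j}\big(P(z_i)\partial_{z_i}-P(z_j)\partial_{z_j}\big)-a\sum_{i<j}\frac{P(z_i)+P(z_j)}{(z_i-z_j)^2}(1+S_{ij})\\&+a\sum_{i<j}\big(c_{++}(z_i+z_j)^2+c_{0+}(z_i+z_j)+c_{00}\big)S_{ij}+\frac{a^2}{12}c_{00}{\sum_{i,j,k}}'(1-S_{ij}S_{ik}).\end{aligned}$$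 *(i) $\overline H$ is obtained from $H^*$ by the substitution $K_{ij}\to-S_{ij}$.* If $\varphi:\mathbb R^N\to\mathfrak S$ satisfies $K_{ij}\varphi=-S_{ij}\varphi$ for all $i\ne j$, then $H^*\varphi=\overline H\varphi$ at every point $\mathbf z$ with pairwise distinct coordinates near which $\varphi$ is $C^2$. *(ii) Reduction.* For $i=1,\dots,N$ let $I_i\subset\mathbb R$ be an open interval on which $P>0$, let $c_i\in I_i$ and $\tau_i\in\mathbb R$, and put $$x_i=\chi_i(z_i)=\tau_i+\int_{c_i}^{z_i}\frac{dy}{\sqrt{P(y)}},\qquad \mu(\mathbf z)=\prod_{i<j}|z_i-z_j|^a\prod_{i}P(z_i)^{-1/4}\exp\int_{c_i}^{z_i}\frac{\tilde Q(y)}{2P(y)}\,dy .$$ Each $\chi_i$ is a $C^\infty$ diffeomorphism of $I_i$ onto an open set; let $\boldsymbol\zeta(\mathbf x)=(\chi_1^{-1}(x_1),\dots,\chi_N^{-1}(x_N))$. On $D=\{\mathbf z: z_i\in I_i,\ z_i\neq z_j \text{ for } i\ne j\}$ the function $\mu$ is positive and $C^\infty$. On $\boldsymbol\chi(D)$, where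 $\boldsymbol\chi(\mathbf z)=(\chi_1(z_1),\dots,\chi_N(z_N))$, one has $$\mu\,\overline H\,\mu^{-1}\Big|_{\mathbf z=\boldsymbol\zeta(\mathbf x)}=-\sum_i\partial_{x_i}^2+V(\mathbf x),$$ that is, both sides agree at each $\mathbf x\in\boldsymbol\chi(D)$ on every $\mathfrak S$-valued function that is $C^2$ near $\mathbf x$. Here $V(\mathbf x)$ is the Hermitian matrix $$\begin{aligned}V(\mathbf x)={}&a^2{\sum_{i,j,k}}'\frac{P(z_i)}{(z_i-z_j)(z_i-z_k)}+a\sum_{i\ne j}\frac{\tilde Q(z_i)}{z_i-z_j}+a\sum_{i<j}\frac{P(z_i)+P(z_j)}{(z_i-z_j)^2}(a+S_{ij})\\&-2ac_{++}(1-m)\sum_{i<j}z_iz_j-a\sum_{i<j}\big(c_{++}(z_i+z_j)^2+c_{0+}(z_i+z_j)+c_{00}\big)S_{ij}\\&+\frac14\sum_i\Big[\frac1{P(z_i)}\Big(\tfrac34P'(z_i)^2+\tilde Q(z_i)^2-2\tilde Q(z_i)P'(z_i)\Big)-P''(z_i)+2\tilde Q'(z_i)-4R(z_i)\Big]\\&-\frac{a^2}{12}c_{00}{\sum_{i,j,k}}'(1-S_{ij}S_{ik})\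 \Big|_{\mathbf z=\boldsymbol\zeta(\mathbf x)} .\end{aligned}$$ -/

import Mathlib

open scoped Matrix ContDiff

noncomputable section

namespace SpinCS

/-- The parameters: the real coupling `a`, the non-negative integer `m`, and the real coefficients
`c₊₊, c₀₊, c₀₀, c₀₋, c₋₋, c₊, c₀, c₋` of the quadratic combination of Dunkl operators. -/
structure Params where
  a : ℝ
  m : ℕ
  cpp : ℝ
  c0p : ℝ
  c00 : ℝ
  c0m : ℝ
  cmm : ℝ
  cp : ℝ
  c0 : ℝ
  cm : ℝ

/-- Coordinates of `N` particles on the line. -/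
abbrev Pt (N : ℕ) : Type := Fin N → ℝ

/-- The basis labels `(s₁, …, s_N)`. Each spin takes the `twoM + 1` values `-M, -M + 1, …, M`,
numbered from `0` to `twoM = 2M`. -/
abbrev Spins (N twoM : ℕ) : Type := Fin N → Fin (twoM + 1)

/-- The spin space, with the basis `|s₁, …, s_N⟩ = Pi.single s 1`. -/
abbrev SpinSpace (N twoM : ℕ) : Type := Spins N twoM → ℂ

/-- Functions of the coordinates with values in the spin space. -/
abbrev SpinFun (N twoM : ℕ) : Type := Pt N → SpinSpace N twoM

/-- Linear operators on the spin space, as matrices in the basis `|s₁, …, s_N⟩`. -/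
abbrev SpinMat (N twoM : ℕ) : Type := Matrix (Spins N twoM) (Spins N twoM) ℂ

variable {N twoM : ℕ}

/-- The partial derivative with respect to the `i`-th coordinate. -/
def pd (i : Fin N) (φ : SpinFun N twoM) : SpinFun N twoM := fun z =>
  deriv (fun t : ℝ => φ (Function.update z i t)) (z i)

/-- The coordinate permutation operator `K_ij`. -/
def K (i j : Fin N) (φ : SpinFun N twoM) : SpinFun N twoM := fun z =>
  φ (z ∘ Equiv.swap i j)

/-- The spin permutation operator `S_ij`: its column `s` is `|s⟩` with `s_i`, `s_j` exchanged. -/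
def S (twoM : ℕ) (i j : Fin N) : SpinMat N twoM :=
  Matrix.of fun t s => if t = s ∘ Equiv.swap i j then 1 else 0

/-! ### Dunkl operators -/

/-- The Dunkl operator `J_i^-`. -/
def Jminus (p : Params) (i : Fin N) (φ : SpinFun N twoM) : SpinFun N twoM := fun z =>
  pd i φ z + p.a • ∑ j ∈ Finset.univ.erase i, (1 / (z i - z j)) • (φ z - K i j φ z)

/-- The Dunkl operator `J_i^0`. -/
def Jzero (p : Params) (i : Fin N) (φ : SpinFun N twoM) : SpinFun N twoM := fun z =>
  z i • pd i φ z - ((p.m : ℝ) / 2) • φ z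
    + (p.a / 2) • ∑ j ∈ Finset.univ.erase i,
        ((z i + z j) / (z i - z j)) • (φ z - K i j φ z)

/-- The Dunkl operator `J_i^+`. -/
def Jplus (p : Params) (i : Fin N) (φ : SpinFun N twoM) : SpinFun N twoM := fun z =>
  (z i) ^ 2 • pd i φ z - ((p.m : ℝ) * z i) • φ z
    + p.a • ∑ j ∈ Finset.univ.erase i, (z i * z j / (z i - z j)) • (φ z - K i j φ z)

/-- The general quadratic combination `H*` of the Dunkl operators. -/
def Hstar (p : Params) (φ : SpinFun N twoM) : SpinFun N twoM := fun z =>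
  -∑ i, (p.cpp • Jplus p i (Jplus p i φ) z
      + p.c00 • Jzero p i (Jzero p i φ) z
      + p.cmm • Jminus p i (Jminus p i φ) z
      + (p.c0p / 2) • (Jzero p i (Jplus p i φ) z + Jplus p i (Jzero p i φ) z)
      + (p.c0m / 2) • (Jzero p i (Jminus p i φ) z + Jminus p i (Jzero p i φ) z)
      + p.cp • Jplus p i φ z + p.c0 • Jzero p i φ z + p.cm • Jminus p i φ z)

/-- Spin functions antisymmetric under simultaneous exchange of the coordinates and spins of two
particles, that is `K_ij φ = -S_ij φ` for `i ≠ j`. -/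
def IsAntisymm (φ : SpinFun N twoM) : Prop :=
  ∀ i j : Fin N, i ≠ j → ∀ z, K i j φ z = -(S twoM i j *ᵥ φ z)

/-! ### The gauge spin Hamiltonian -/

/-- `P(z) = c₊₊ z⁴ + c₀₊ z³ + c₀₀ z² + c₀₋ z + c₋₋`. -/
def P (p : Params) : Polynomial ℝ :=
  Polynomial.C p.cpp * Polynomial.X ^ 4 + Polynomial.C p.c0p * Polynomial.X ^ 3
    + Polynomial.C p.c00 * Polynomial.X ^ 2 + Polynomial.C p.c0m * Polynomial.X
    + Polynomial.C p.cmm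

/-- `Q(z) = c₊ z² + c₀ z + c₋`. -/
def Q (p : Params) : Polynomial ℝ :=
  Polynomial.C p.cp * Polynomial.X ^ 2 + Polynomial.C p.c0 * Polynomial.X + Polynomial.C p.cm

/-- `b = 1 + m + a (N - 1)`. -/
def b (N : ℕ) (p : Params) : ℝ := 1 + p.m + p.a * ((N : ℝ) - 1)

/-- `Q̃ = Q + (1 - b/2) P'`. -/
def Qt (N : ℕ) (p : Params) : Polynomial ℝ :=
  Q p + Polynomial.C (1 - b N p / 2) * Polynomial.derivative (P p)

/-- The function `R`. -/
def R (N : ℕ) (p : Params) (y : ℝ) : ℝ :=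
  p.cpp * (b N p + p.m * ((p.m : ℝ) - 2) - 1) * y ^ 2
    + (p.c0p * ((1 - (p.m : ℝ) / 2) * b N p + p.m * ((p.m : ℝ) - 1) - 1) - p.m * p.cp) * y
    + p.c00 / 4 * (2 * (b N p - 1) + p.m * ((p.m : ℝ) - 2)) - (p.m : ℝ) / 2 * p.c0

/-- `∑_{i<j} f i j`. -/
def sumLT {M : Type*} [AddCommMonoid M] (f : Fin N → Fin N → M) : M :=
  ∑ i, ∑ j ∈ Finset.univ.filter (fun j => i < j), f i j

/-- The sum of `f i j k` over pairwise distinct `i, j, k`. -/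
def sumDistinct {M : Type*} [AddCommMonoid M] (f : Fin N → Fin N → Fin N → M) : M :=
  ∑ i, ∑ j, ∑ k ∈ Finset.univ.filter (fun k => i ≠ j ∧ j ≠ k ∧ k ≠ i), f i j k

/-- The gauge spin Hamiltonian `H̄`, a matrix differential operator. -/
def Hbar (p : Params) (φ : SpinFun N twoM) : SpinFun N twoM := fun z =>
  -(∑ i, ((P p).eval (z i) • pd i (pd i φ) z + (Qt N p).eval (z i) • pd i φ z
        + R N p (z i) • φ z)
    + (2 * p.a * p.cpp * (1 - (p.m : ℝ)) * sumLT fun i j => z i * z j) • φ z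
    + (2 * p.a) • (sumLT fun i j => (1 / (z i - z j)) •
        ((P p).eval (z i) • pd i φ z - (P p).eval (z j) • pd j φ z))
    - p.a • (sumLT fun i j => (((P p).eval (z i) + (P p).eval (z j)) / (z i - z j) ^ 2) •
        ((1 + S twoM i j) *ᵥ φ z))
    + p.a • (sumLT fun i j =>
        (p.cpp * (z i + z j) ^ 2 + p.c0p * (z i + z j) + p.c00) • (S twoM i j *ᵥ φ z))
    + (p.a ^ 2 / 12 * p.c00) •
        (sumDistinct fun i j k => (1 - S twoM i j * S twoM i k) *ᵥ φ z))

/-! ### Change of variables, gauge factor and potential -/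

/-- One coordinate of the change of variables: `x = τ + ∫_{c}^{y} du / √P(u)`. -/
def chi (p : Params) (c τ y : ℝ) : ℝ := τ + ∫ u in c..y, 1 / √((P p).eval u)

/-- The inverse `ζ` of `chi` on the interval `I`. -/
def zeta (p : Params) (I : Set ℝ) (c τ : ℝ) : ℝ → ℝ := Function.invFunOn (chi p c τ) I

/-- The map `z ↦ x`, coordinate by coordinate. -/
def chiMap (p : Params) (c τ : Fin N → ℝ) (z : Pt N) : Pt N := fun i => chi p (c i) (τ i) (z i)

/-- The map `x ↦ z = ζ(x)`, coordinate by coordinate. -/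
def zetaMap (p : Params) (I : Fin N → Set ℝ) (c τ : Fin N → ℝ) (x : Pt N) : Pt N :=
  fun i => zeta p (I i) (c i) (τ i) (x i)

/-- The domain in the `z` coordinates: `z_i ∈ I_i`, and no two particles coincide. -/
def zDom (I : Fin N → Set ℝ) : Set (Pt N) := {z | (∀ i, z i ∈ I i) ∧ Function.Injective z}

/-- The domain in the `x` coordinates, the image of `zDom`. -/
def xDom (p : Params) (I : Fin N → Set ℝ) (c τ : Fin N → ℝ) : Set (Pt N) :=
  chiMap p c τ '' zDom I

/-- The gauge factor
`μ(z) = ∏_{i<j} |z_i - z_j|^a ∏_i P(z_i)^{-1/4} exp ∫_{c_i}^{z_i} Q̃ / (2P)`. -/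
def mu (p : Params) (c : Fin N → ℝ) (z : Pt N) : ℝ :=
  (∏ i, ∏ j ∈ Finset.univ.filter (fun j => i < j), |z i - z j| ^ p.a) *
    ∏ i, ((P p).eval (z i) ^ (-(1 / 4) : ℝ) *
      Real.exp (∫ u in (c i)..(z i), (Qt N p).eval u / (2 * (P p).eval u)))

/-- The matrix potential, as a function of the `z` coordinates. -/
def potZ (twoM : ℕ) (p : Params) (z : Pt N) : SpinMat N twoM :=
  (p.a ^ 2 * sumDistinct fun i j k =>
      (P p).eval (z i) / ((z i - z j) * (z i - z k))) • (1 : SpinMat N twoM)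
  + (p.a * ∑ i, ∑ j ∈ Finset.univ.erase i, (Qt N p).eval (z i) / (z i - z j)) •
      (1 : SpinMat N twoM)
  + p.a • (sumLT fun i j => (((P p).eval (z i) + (P p).eval (z j)) / (z i - z j) ^ 2) •
      (p.a • (1 : SpinMat N twoM) + S twoM i j))
  - (2 * p.a * p.cpp * (1 - (p.m : ℝ)) * sumLT fun i j => z i * z j) • (1 : SpinMat N twoM)
  - p.a • (sumLT fun i j =>
      (p.cpp * (z i + z j) ^ 2 + p.c0p * (z i + z j) + p.c00) • S twoM i j)
  + (1 / 4 * ∑ i,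
      (1 / (P p).eval (z i) *
          (3 / 4 * (P p).derivative.eval (z i) ^ 2 + (Qt N p).eval (z i) ^ 2
            - 2 * (Qt N p).eval (z i) * (P p).derivative.eval (z i))
        - (P p).derivative.derivative.eval (z i) + 2 * (Qt N p).derivative.eval (z i)
        - 4 * R N p (z i))) • (1 : SpinMat N twoM)
  - (p.a ^ 2 / 12 * p.c00) • (sumDistinct fun i j k => 1 - S twoM i j * S twoM i k)

/-- The matrix Schrödinger operator `-∑ ∂²_{x_i} + V(x)`. -/
def schrodinger (V : Pt N → SpinMat N twoM) (ψ : SpinFun N twoM) : SpinFun N twoM := fun x =>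
  -∑ i, pd i (pd i ψ) x + V x *ᵥ ψ x

/-- The operator `μ A μ⁻¹` written in the variables `x`, where `x = χ(z)` and `z = ζ(x)`. -/
def gaugeTransform (μ : Pt N → ℝ) (χ ζ : Pt N → Pt N)
    (A : SpinFun N twoM → SpinFun N twoM) (ψ : SpinFun N twoM) : SpinFun N twoM := fun x =>
  μ (ζ x) • A (fun z => (μ z)⁻¹ • ψ (χ z)) (ζ x)

end SpinCS

end

/-!
The Dunkl operators `J_i^-`, `J_i^0`, `J_i^+` are the members with weight `w = 1`, `y`, `y²` of one
family `dunkl p w i`, linear in the quadratic polynomial `w`: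
`w(z_i) ∂_i - (m/2) w'(z_i) + a ∑_j w(z_i, z_j) / (z_i - z_j) (1 - K_ij)`, where `w(x, y)` is the
polarization of `w`. Let `φ` be antisymmetric. Then `K_ij φ = -S_ij φ`, and equivariance gives
`K_ij J_i φ = -S_ij J_j φ` (`IsAntisymm.dunkl_comp_swap`). Relabelling the particles turns the
exchange term of the outer operator in `∑_i J_u J_v φ` into
`a ∑_{i ≠ j} u(z_i, z_j) / (z_i - z_j) (1 - S_ij) J_v φ`, so that `∑_i J_u J_v φ` is a sum of one-,
two- and three-particle terms (`IsAntisymm.sum_dunkl_dunkl`). In the combination defining `H*` these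
match the terms of the gauge spin Hamiltonian separately, once the part `a (N - 1)` of `b` is
distributed over the pairs: `onePart_comb`, `pairPart_comb`, and for the triples
`sumDistinct_tripleSpin` with `exchCoeff_cyclic`. In the last, the cyclic sums of the rational
coefficients cancel except for a constant coming from `(J⁰)²`.

For the reduction, `μ = exp L` on the domain (`mu_eq_exp`), with `∂_i L` the explicit function
`gaugeGrad`, equal to `(A_i - P'/2) / (2P)` where `A_i` is the total coefficient of `∂_i` in `-H̄`.
Along each coordinate line the first two derivatives of `μ⁻¹ (ψ ∘ χ)` follow from the product and
chain rules with `χ' = P^{-1/2}` (`deriv_gauge`, `pd_gauge`). The second-order part of `-H̄` becomes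
`∑ ∂²_{x_i}`, the first-order part cancels, and the remaining scalar is `gauge_scalar`. The spin
matrices commute with scalar functions and pass through unchanged. Since `χ_i' > 0`, each `χ_i` is
injective and open and its inverse is smooth.
-/

noncomputable section

namespace SpinCS

variable {N twoM : ℕ}

/-! ### Sums over pairs and triples of particles -/

section Sums
variable {M : Type*} [AddCommMonoid M]

theorem sum_erase_eq_sum_ite (f : Fin N → Fin N → M) :
    ∑ i, ∑ j ∈ Finset.univ.erase i, f i j = ∑ i, ∑ j, if i ≠ j then f i j else 0 := by
  refine Finset.sum_congr rfl fun i _ => ?_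
  rw [← Finset.sum_filter]
  congr 1
  ext j
  simp [eq_comm]

theorem sum_erase_swap (f : Fin N → Fin N → M) :
    ∑ i, ∑ j ∈ Finset.univ.erase i, f i j = ∑ i, ∑ j ∈ Finset.univ.erase i, f j i := by
  rw [sum_erase_eq_sum_ite, sum_erase_eq_sum_ite, Finset.sum_comm]
  simp only [ne_comm]

theorem sum_erase_eq_sumLT (f : Fin N → Fin N → M) :
    ∑ i, ∑ j ∈ Finset.univ.erase i, f i j = sumLT fun i j => f i j + f j i := by
  have h : ∀ i j : Fin N, (if i ≠ j then f i j else 0)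
      = (if i < j then f i j else 0) + (if j < i then f i j else 0) := by
    intro i j
    rcases lt_trichotomy i j with h | h | h
    · simp [h, h.ne, h.not_gt]
    · simp [h]
    · simp [h, h.ne', h.not_gt]
  rw [sum_erase_eq_sum_ite]
  simp only [sumLT, h, Finset.sum_add_distrib, Finset.sum_filter]
  congr 1
  exact Finset.sum_comm

theorem sumLT_congr {f g : Fin N → Fin N → M} (h : ∀ i j, i ≠ j → f i j = g i j) :
    sumLT f = sumLT g :=
  Finset.sum_congr rfl fun i _ => Finset.sum_congr rfl fun j hj =>
    h i j (Finset.mem_filter.1 hj).2.ne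

theorem sumLT_add (f g : Fin N → Fin N → M) :
    sumLT (fun i j => f i j + g i j) = sumLT f + sumLT g := by
  simp only [sumLT, Finset.sum_add_distrib]

theorem sumDistinct_eq (f : Fin N → Fin N → Fin N → M) :
    sumDistinct f = ∑ i, ∑ j, ∑ k, if i ≠ j ∧ j ≠ k ∧ k ≠ i then f i j k else 0 := by
  simp only [sumDistinct, Finset.sum_filter]

theorem sumDistinct_congr {f g : Fin N → Fin N → Fin N → M}
    (h : ∀ i j k, i ≠ j → j ≠ k → k ≠ i → f i j k = g i j k) :
    sumDistinct f = sumDistinct g :=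
  Finset.sum_congr rfl fun i _ => Finset.sum_congr rfl fun j _ => Finset.sum_congr rfl fun k hk =>
    have hk := (Finset.mem_filter.1 hk).2
    h i j k hk.1 hk.2.1 hk.2.2

theorem sumDistinct_add (f g : Fin N → Fin N → Fin N → M) :
    sumDistinct (fun i j k => f i j k + g i j k) = sumDistinct f + sumDistinct g := by
  simp only [sumDistinct, Finset.sum_add_distrib]

theorem sumDistinct_swap (f : Fin N → Fin N → Fin N → M) :
    sumDistinct f = sumDistinct fun i j k => f i k j := by
  rw [sumDistinct_eq, sumDistinct_eq]
  refine Finset.sum_congr rfl fun i _ => ?_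
  rw [Finset.sum_comm]
  refine Finset.sum_congr rfl fun j _ => Finset.sum_congr rfl fun k _ => ?_
  congr 1
  simp only [ne_comm, eq_iff_iff]
  tauto

theorem sumDistinct_rotate (f : Fin N → Fin N → Fin N → M) :
    sumDistinct f = sumDistinct fun i j k => f j k i := by
  rw [sumDistinct_eq, sumDistinct_eq, Finset.sum_comm_cycle]
  refine Finset.sum_congr rfl fun i _ => Finset.sum_congr rfl fun j _ =>
    Finset.sum_congr rfl fun k _ => ?_
  congr 1
  simp only [eq_iff_iff]
  tauto

/-- A double sum over `j, k ≠ i` splits into the diagonal and the pairwise distinct triples. -/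
theorem sum_erase_erase (f : Fin N → Fin N → Fin N → M) :
    ∑ i, ∑ j ∈ Finset.univ.erase i, ∑ k ∈ Finset.univ.erase i, f i j k
      = ∑ i, ∑ j ∈ Finset.univ.erase i, f i j j + sumDistinct f := by
  have h : ∀ i, ∀ j ∈ Finset.univ.erase i, ∑ k ∈ Finset.univ.erase i, f i j k
      = f i j j + ∑ k, if i ≠ j ∧ j ≠ k ∧ k ≠ i then f i j k else 0 := by
    intro i j hj
    rw [← Finset.add_sum_erase _ _ hj, ← Finset.sum_filter]
    congr 2
    ext k
    have hij : j ≠ i := Finset.ne_of_mem_erase hj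
    simp only [Finset.mem_erase, Finset.mem_univ, Finset.mem_filter, and_true, true_and]
    constructor
    · rintro ⟨h1, h2⟩
      exact ⟨hij.symm, h1.symm, h2⟩
    · rintro ⟨-, h1, h2⟩
      exact ⟨h1.symm, h2⟩
  rw [Finset.sum_congr rfl fun i _ => Finset.sum_congr rfl (h i)]
  simp only [Finset.sum_add_distrib, sumDistinct_eq]
  congr 1
  refine Finset.sum_congr rfl fun i _ => ?_
  refine Finset.sum_erase _ ?_
  simp

theorem sum_erase_const {V : Type*} [AddCommGroup V] [Module ℝ V] (f : Fin N → V) :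
    ∑ i, ∑ _j ∈ Finset.univ.erase i, f i = ((N : ℝ) - 1) • ∑ i, f i := by
  rw [Finset.smul_sum]
  refine Finset.sum_congr rfl fun i _ => ?_
  have hN : 1 ≤ N := Nat.one_le_of_lt i.isLt
  rw [Finset.sum_const, Finset.card_erase_of_mem (Finset.mem_univ i), Finset.card_univ,
    Fintype.card_fin, ← Nat.cast_smul_eq_nsmul ℝ, Nat.cast_sub hN, Nat.cast_one]

theorem smul_sumLT {V : Type*} [AddCommGroup V] [Module ℝ V] (r : ℝ) (f : Fin N → Fin N → V) :
    r • sumLT f = sumLT fun i j => r • f i j := by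
  simp only [sumLT, Finset.smul_sum]

theorem sumLT_smul {V : Type*} [AddCommGroup V] [Module ℝ V] (f : Fin N → Fin N → ℝ) (v : V) :
    sumLT f • v = sumLT fun i j => f i j • v := by
  simp only [sumLT, Finset.sum_smul]

theorem sumLT_sub {V : Type*} [AddCommGroup V] (f g : Fin N → Fin N → V) :
    sumLT (fun i j => f i j - g i j) = sumLT f - sumLT g := by
  simp only [sumLT, Finset.sum_sub_distrib]

theorem smul_sumDistinct {V : Type*} [AddCommGroup V] [Module ℝ V] (r : ℝ)
    (f : Fin N → Fin N → Fin N → V) :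
    r • sumDistinct f = sumDistinct fun i j k => r • f i j k := by
  simp only [sumDistinct, Finset.smul_sum]

end Sums

/-! ### Spin permutations -/

/-- The spin permutation `S_ij` as a continuous real-linear operator on the spin space. -/
def spinPerm (i j : Fin N) : SpinSpace N twoM →L[ℝ] SpinSpace N twoM :=
  LinearMap.toContinuousLinearMap
    (LinearMap.funLeft ℝ ℂ fun t : Spins N twoM => t ∘ Equiv.swap i j)

theorem spinPerm_apply (i j : Fin N) (v : SpinSpace N twoM) (t : Spins N twoM) :
    spinPerm i j v t = v (t ∘ Equiv.swap i j) := rfl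

theorem comp_swap_comp_swap {α : Type*} (i j : Fin N) (t : Fin N → α) :
    (t ∘ Equiv.swap i j) ∘ Equiv.swap i j = t := by
  ext k
  simp

theorem S_apply (i j : Fin N) (t s : Spins N twoM) :
    S twoM i j t s = if s = t ∘ Equiv.swap i j then 1 else 0 := by
  have h : t = s ∘ Equiv.swap i j ↔ s = t ∘ Equiv.swap i j := by
    constructor <;> rintro rfl <;> rw [comp_swap_comp_swap]
  simp only [S, Matrix.of_apply, h]

theorem S_mulVec (i j : Fin N) (v : SpinSpace N twoM) :
    S twoM i j *ᵥ v = spinPerm i j v := by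
  ext t
  simp [Matrix.mulVec, dotProduct, S_apply, spinPerm_apply]

theorem S_isHermitian (i j : Fin N) : (S twoM i j).IsHermitian := by
  ext t s
  rw [Matrix.conjTranspose_apply, S_apply]
  simp only [S, Matrix.of_apply]
  split_ifs <;> simp

theorem spinPerm_comm (i j : Fin N) :
    (spinPerm i j : SpinSpace N twoM →L[ℝ] SpinSpace N twoM) = spinPerm j i := by
  ext v t
  rw [spinPerm_apply, spinPerm_apply, Equiv.swap_comm]

theorem spinPerm_self_apply (i j : Fin N) (v : SpinSpace N twoM) :
    spinPerm i j (spinPerm i j v) = v := by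
  ext t
  rw [spinPerm_apply, spinPerm_apply, comp_swap_comp_swap]

/-- Conjugation rule `S_kl S_ij = S_ij S_σ(k)σ(l)`, with `σ` the exchange of `i` and `j`. -/
theorem spinPerm_spinPerm (i j k l : Fin N) (v : SpinSpace N twoM) :
    spinPerm k l (spinPerm i j v)
      = spinPerm i j (spinPerm (Equiv.swap i j k) (Equiv.swap i j l) v) := by
  ext t
  simp only [spinPerm_apply, Function.comp_assoc]
  congr 2
  rw [← Equiv.Perm.coe_mul, ← Equiv.Perm.coe_mul, Equiv.swap_mul_eq_mul_swap, Equiv.swap_inv]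

/-! ### Dunkl operators with a quadratic weight -/

/-- The quadratic polynomial `w₀ + w₁ y + w₂ y²`. -/
def weight (w : ℝ × ℝ × ℝ) (y : ℝ) : ℝ := w.1 + w.2.1 * y + w.2.2 * y ^ 2

/-- The derivative of `weight w`. -/
def weightDeriv (w : ℝ × ℝ × ℝ) (y : ℝ) : ℝ := w.2.1 + 2 * w.2.2 * y

/-- The polarization of `weight w`: symmetric, affine in each variable, and equal to `weight w` on
the diagonal. -/
def weightPolar (w : ℝ × ℝ × ℝ) (x y : ℝ) : ℝ := w.1 + w.2.1 * (x + y) / 2 + w.2.2 * (x * y)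

/-- The coefficient of the exchange term of particles at `x` and `y` in a Dunkl operator. -/
def exchCoeff (w : ℝ × ℝ × ℝ) (x y : ℝ) : ℝ := weightPolar w x y / (x - y)

/-- The derivative of `exchCoeff w x y` in `x`. -/
def exchCoeffDeriv (w : ℝ × ℝ × ℝ) (x y : ℝ) : ℝ :=
  ((w.2.1 / 2 + w.2.2 * y) * (x - y) - weightPolar w x y) / (x - y) ^ 2

/-- The Dunkl operator whose leading term is `weight w ∂_i`. The weights `1`, `y`, `y²` give
`J_i^-`, `J_i^0`, `J_i^+`. -/
def dunkl (p : Params) (w : ℝ × ℝ × ℝ) (i : Fin N) (φ : SpinFun N twoM) : SpinFun N twoM := fun z =>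
  weight w (z i) • pd i φ z - ((p.m : ℝ) / 2 * weightDeriv w (z i)) • φ z
    + p.a • ∑ j ∈ Finset.univ.erase i, exchCoeff w (z i) (z j) • (φ z - K i j φ z)

theorem Jminus_eq_dunkl (p : Params) (i : Fin N) :
    (Jminus p i : SpinFun N twoM → SpinFun N twoM) = dunkl p (1, 0, 0) i := by
  ext φ z
  simp [Jminus, dunkl, weight, weightDeriv, exchCoeff, weightPolar]

theorem Jzero_eq_dunkl (p : Params) (i : Fin N) :
    (Jzero p i : SpinFun N twoM → SpinFun N twoM) = dunkl p (0, 1, 0) i := by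
  funext φ z
  have h : ∀ x y : ℝ, exchCoeff (0, 1, 0) x y = 1 / 2 * ((x + y) / (x - y)) := fun x y => by
    simp only [exchCoeff, weightPolar]
    ring
  have hw : weight (0, 1, 0) (z i) = z i := by simp [weight]
  have hw' : weightDeriv (0, 1, 0) (z i) = 1 := by simp [weightDeriv]
  rw [Jzero, dunkl, hw, hw', mul_one, div_eq_mul_one_div p.a, mul_smul, Finset.smul_sum]
  simp only [smul_smul, h]

theorem Jplus_eq_dunkl (p : Params) (i : Fin N) :
    (Jplus p i : SpinFun N twoM → SpinFun N twoM) = dunkl p (0, 0, 1) i := by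
  ext φ z
  have h : ∀ x : ℝ, (p.m : ℝ) / 2 * (2 * x) = p.m * x := fun x => by ring
  simp [Jplus, dunkl, weight, weightDeriv, exchCoeff, weightPolar, h]

theorem exchCoeff_swap (w : ℝ × ℝ × ℝ) (x y : ℝ) : exchCoeff w y x = -exchCoeff w x y := by
  have h : weightPolar w y x = weightPolar w x y := by simp only [weightPolar]; ring
  rw [exchCoeff, exchCoeff, h, ← neg_sub x y, div_neg]

theorem hasDerivAt_weight (w : ℝ × ℝ × ℝ) (y : ℝ) :
    HasDerivAt (weight w) (weightDeriv w y) y := by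
  have h := (((hasDerivAt_id y).const_mul w.2.1).const_add w.1).add
    (((hasDerivAt_id y).pow 2).const_mul w.2.2)
  refine h.congr_deriv ?_
  simp only [weightDeriv, id]
  push_cast
  ring

theorem hasDerivAt_weightDeriv (w : ℝ × ℝ × ℝ) (y : ℝ) :
    HasDerivAt (weightDeriv w) (2 * w.2.2) y := by
  have h := ((hasDerivAt_id y).const_mul (2 * w.2.2)).const_add w.2.1
  exact h.congr_deriv (mul_one _)

theorem hasDerivAt_exchCoeff (w : ℝ × ℝ × ℝ) {x y : ℝ} (h : x ≠ y) :
    HasDerivAt (fun t => exchCoeff w t y) (exchCoeffDeriv w x y) x := by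
  have h1 : HasDerivAt (fun t => weightPolar w t y) (w.2.1 / 2 + w.2.2 * y) x := by
    have h := (((((hasDerivAt_id x).add_const y).const_mul w.2.1).div_const 2).const_add w.1).add
      (((hasDerivAt_id x).mul_const y).const_mul w.2.2)
    refine h.congr_deriv ?_
    ring
  have h2 := h1.div ((hasDerivAt_id x).sub_const y) (sub_ne_zero.2 h)
  refine h2.congr_deriv ?_
  simp only [exchCoeffDeriv, id, mul_one]

/-! ### Partial derivatives of spin functions -/

theorem hasDerivAt_line {φ : SpinFun N twoM} {z : Pt N} (i : Fin N)
    (h : DifferentiableAt ℝ φ z) :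
    HasDerivAt (fun t : ℝ => φ (Function.update z i t)) (pd i φ z) (z i) := by
  have h1 : DifferentiableAt ℝ (fun t : ℝ => φ (Function.update z i t)) (z i) := by
    refine DifferentiableAt.comp (z i) (g := φ) (f := Function.update z i) ?_
      (hasDerivAt_update z i (z i)).differentiableAt
    rwa [Function.update_eq_self]
  exact h1.hasDerivAt

theorem pd_update (i : Fin N) (φ : SpinFun N twoM) (z : Pt N) (t : ℝ) :
    pd i φ (Function.update z i t) = deriv (fun s => φ (Function.update z i s)) t := by
  simp [pd]

theorem hasDerivAt_pd_line {φ : SpinFun N twoM} {z : Pt N} (i : Fin N)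
    (h : ContDiffAt ℝ 2 φ z) :
    HasDerivAt (fun t : ℝ => pd i φ (Function.update z i t)) (pd i (pd i φ) z) (z i) := by
  have h1 : ContDiffAt ℝ 2 (fun t : ℝ => φ (Function.update z i t)) (z i) := by
    refine ContDiffAt.comp (z i) (g := φ) (f := Function.update z i) ?_
      (contDiff_update 2 z i).contDiffAt
    rwa [Function.update_eq_self]
  have h2 : DifferentiableAt ℝ (deriv fun t : ℝ => φ (Function.update z i t)) (z i) :=
    ((h1.fderiv_right (m := 1) (by norm_num)).differentiableAt one_ne_zero).clm_apply
      (differentiableAt_const 1)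
  have h3 : (fun t : ℝ => pd i φ (Function.update z i t))
      = deriv fun t : ℝ => φ (Function.update z i t) := funext fun t => pd_update i φ z t
  rw [← h3] at h2
  exact h2.hasDerivAt

theorem update_comp_swap (z : Pt N) (i j : Fin N) (t : ℝ) :
    Function.update (z ∘ Equiv.swap i j) i t = Function.update z j t ∘ Equiv.swap i j := by
  have := Function.update_comp_equiv z (Equiv.swap i j) j t
  rw [this]
  simp

/-! ### The action on antisymmetric spin functions -/

theorem IsAntisymm.comp_swap {φ : SpinFun N twoM} (h : IsAntisymm φ) {i j : Fin N} (hij : i ≠ j)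
    (z : Pt N) : φ (z ∘ Equiv.swap i j) = -spinPerm i j (φ z) := by
  rw [← S_mulVec]
  exact h i j hij z

theorem IsAntisymm.dunkl_apply {φ : SpinFun N twoM} (h : IsAntisymm φ) (p : Params)
    (w : ℝ × ℝ × ℝ) (i : Fin N) (z : Pt N) :
    dunkl p w i φ z = weight w (z i) • pd i φ z - ((p.m : ℝ) / 2 * weightDeriv w (z i)) • φ z
      + p.a • ∑ j ∈ Finset.univ.erase i,
          exchCoeff w (z i) (z j) • (φ z + spinPerm i j (φ z)) := by
  rw [dunkl]
  congr 2
  refine Finset.sum_congr rfl fun j hj => ?_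
  rw [K, h.comp_swap (Finset.ne_of_mem_erase hj).symm, sub_neg_eq_add]

theorem IsAntisymm.pd_comp_swap {φ : SpinFun N twoM} (h : IsAntisymm φ) {i j : Fin N} (hij : i ≠ j)
    {z : Pt N} (hφ : DifferentiableAt ℝ φ z) :
    pd i φ (z ∘ Equiv.swap i j) = -spinPerm i j (pd j φ z) := by
  have h1 : (fun t : ℝ => φ (Function.update (z ∘ Equiv.swap i j) i t))
      = fun t => -spinPerm i j (φ (Function.update z j t)) := by
    funext t
    rw [update_comp_swap, h.comp_swap hij]
  have h2 : (z ∘ Equiv.swap i j) i = z j := by simp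
  rw [pd, h1, h2]
  exact (((spinPerm i j).hasFDerivAt.comp_hasDerivAt (z j) (hasDerivAt_line j hφ)).neg).deriv

/-- Equivariance `K_ij J_i = J_j K_ij`, evaluated on an antisymmetric function. -/
theorem IsAntisymm.dunkl_comp_swap {φ : SpinFun N twoM} (h : IsAntisymm φ) (p : Params)
    (w : ℝ × ℝ × ℝ) {i j : Fin N} (hij : i ≠ j) {z : Pt N} (hφ : DifferentiableAt ℝ φ z) :
    dunkl p w i φ (z ∘ Equiv.swap i j) = -spinPerm i j (dunkl p w j φ z) := by
  have h2 : (z ∘ Equiv.swap i j) i = z j := by simp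
  have hsum : ∑ k ∈ Finset.univ.erase i, exchCoeff w (z j) ((z ∘ Equiv.swap i j) k) •
        (-spinPerm i j (φ z) + spinPerm i k (-spinPerm i j (φ z)))
      = -spinPerm i j (∑ k ∈ Finset.univ.erase j,
          exchCoeff w (z j) (z k) • (φ z + spinPerm j k (φ z))) := by
    rw [map_sum, ← Finset.sum_neg_distrib]
    refine Finset.sum_equiv (Equiv.swap i j) ?_ ?_
    · intro k
      simp only [Finset.mem_erase, Finset.mem_univ, and_true]
      rw [not_iff_not, Equiv.swap_apply_eq_iff, Equiv.swap_apply_right]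
    · intro k _
      rw [map_neg, spinPerm_spinPerm i j i k, Equiv.swap_apply_left]
      simp only [Function.comp_apply, map_smul, map_add]
      module
  rw [h.dunkl_apply, h.dunkl_apply, h.pd_comp_swap hij hφ, h.comp_swap hij, h2, hsum]
  simp only [map_add, map_sub, map_smul]
  module

theorem IsAntisymm.pd_dunkl {φ : SpinFun N twoM} (h : IsAntisymm φ) (p : Params)
    (w : ℝ × ℝ × ℝ) (i : Fin N) {z : Pt N} (hz : Function.Injective z) (hφ : ContDiffAt ℝ 2 φ z) :
    pd i (dunkl p w i φ) z
      = weight w (z i) • pd i (pd i φ) z + weightDeriv w (z i) • pd i φ z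
        - ((p.m : ℝ) / 2 * weightDeriv w (z i)) • pd i φ z
        - ((p.m : ℝ) / 2 * (2 * w.2.2)) • φ z
        + p.a • ∑ j ∈ Finset.univ.erase i,
          (exchCoeff w (z i) (z j) • (pd i φ z + spinPerm i j (pd i φ z))
            + exchCoeffDeriv w (z i) (z j) • (φ z + spinPerm i j (φ z))) := by
  have hφ1 := hasDerivAt_line i (hφ.differentiableAt two_ne_zero)
  have hφ2 := hasDerivAt_pd_line i hφ
  have hs : HasDerivAt (fun t => ∑ j ∈ Finset.univ.erase i, exchCoeff w t (z j) •
      (φ (Function.update z i t) + spinPerm i j (φ (Function.update z i t))))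
      (∑ j ∈ Finset.univ.erase i,
          (exchCoeff w (z i) (z j) • (pd i φ z + spinPerm i j (pd i φ z))
            + exchCoeffDeriv w (z i) (z j) • (φ z + spinPerm i j (φ z)))) (z i) := by
    refine HasDerivAt.fun_sum fun j hj => ?_
    have hne : z i ≠ z j := fun he => Finset.ne_of_mem_erase hj (hz he).symm
    have := (hasDerivAt_exchCoeff w hne).smul
      (hφ1.add ((spinPerm i j).hasFDerivAt.comp_hasDerivAt (z i) hφ1))
    refine this.congr_deriv ?_
    simp
  have hf : (fun t => dunkl p w i φ (Function.update z i t)) = fun t =>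
      weight w t • pd i φ (Function.update z i t)
        - ((p.m : ℝ) / 2 * weightDeriv w t) • φ (Function.update z i t)
      + p.a • ∑ j ∈ Finset.univ.erase i, exchCoeff w t (z j) •
          (φ (Function.update z i t) + spinPerm i j (φ (Function.update z i t))) := by
    funext t
    rw [h.dunkl_apply, Function.update_self]
    congr 2
    refine Finset.sum_congr rfl fun j hj => ?_
    rw [Function.update_of_ne (Finset.ne_of_mem_erase hj)]
  have hd := (((hasDerivAt_weight w (z i)).smul hφ2).sub
    (((hasDerivAt_weightDeriv w (z i)).const_mul ((p.m : ℝ) / 2)).smul hφ1)).add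
    (hs.const_smul p.a)
  rw [pd, hf]
  refine hd.deriv.trans ?_
  simp only [Function.update_eq_self]
  module

/-! ### Products of Dunkl operators -/

section Parts
variable {V : Type*} [AddCommGroup V] [Module ℝ V]

/-- The one-particle part of `J_u J_v φ` at a particle with coordinate `x`, where `F`, `D`, `D2`
are the values of `φ` and of its first two partial derivatives. -/
def onePart (p : Params) (u v : ℝ × ℝ × ℝ) (x : ℝ) (F D D2 : V) : V :=
  (weight u x * weight v x) • D2
    + (weight u x * weightDeriv v x
        - (p.m : ℝ) / 2 * (weight u x * weightDeriv v x + weightDeriv u x * weight v x)) • D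
    + ((p.m : ℝ) ^ 2 / 4 * (weightDeriv u x * weightDeriv v x)
        - (p.m : ℝ) * (weight u x * v.2.2)) • F

/-- The two-particle part of `∑ J_u J_v φ` for particles at `x` and `y`, where `F`, `D` are the
values of `φ` and of its partial derivative in `x`, and `TF`, `TD` are their images under the spin
exchange. -/
def pairPart (p : Params) (u v : ℝ × ℝ × ℝ) (x y : ℝ) (F TF D TD : V) : V :=
  p.a • (weight u x • (exchCoeff v x y • (D + TD) + exchCoeffDeriv v x y • (F + TF))
    - ((p.m : ℝ) / 2 * weightDeriv u x * exchCoeff v x y) • (F + TF)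
    + exchCoeff u x y • (weight v x • (D - TD) - ((p.m : ℝ) / 2 * weightDeriv v x) • (F - TF)))

end Parts

/-- `(1 - S_ij)(1 + S_ik) v`, the spin factor of the three-particle terms. -/
def tripleSpin (i j k : Fin N) (v : SpinSpace N twoM) : SpinSpace N twoM :=
  v + spinPerm i k v - spinPerm i j (v + spinPerm i k v)

/-- In a sum over pairs with antisymmetric coefficients, relabelling the particles replaces
`S_ij y_j` by `-S_ij y_i`. Together with `K_ij J_i φ = -S_ij J_j φ` this makes the exchange term of
the outer Dunkl operator in `∑ J_u J_v φ` act as `1 - S_ij`. -/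
theorem sum_antisymm_coeff (d : Fin N → Fin N → ℝ) (hd : ∀ i j, d j i = -d i j)
    (y : Fin N → SpinSpace N twoM) :
    ∑ i, ∑ j ∈ Finset.univ.erase i, d i j • (y i + spinPerm i j (y j))
      = ∑ i, ∑ j ∈ Finset.univ.erase i, d i j • (y i - spinPerm i j (y i)) := by
  have h : ∑ i, ∑ j ∈ Finset.univ.erase i, d i j • spinPerm i j (y j)
      = ∑ i, ∑ j ∈ Finset.univ.erase i, -(d i j • spinPerm i j (y i)) := by
    rw [sum_erase_swap]
    refine Finset.sum_congr rfl fun i _ => Finset.sum_congr rfl fun j _ => ?_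
    rw [hd, spinPerm_comm, neg_smul]
  simp only [smul_add, sub_eq_add_neg, smul_neg, Finset.sum_add_distrib, h]

theorem IsAntisymm.sum_dunkl {φ : SpinFun N twoM} (h : IsAntisymm φ) (p : Params)
    (w : ℝ × ℝ × ℝ) (z : Pt N) :
    ∑ i, dunkl p w i φ z
      = ∑ i, (weight w (z i) • pd i φ z - ((p.m : ℝ) / 2 * weightDeriv w (z i)) • φ z) := by
  simp only [h.dunkl_apply, Finset.sum_add_distrib (f := fun i => _ - _), ← Finset.smul_sum]
  rw [sum_erase_eq_sumLT, sumLT_congr (g := fun _ _ => 0)]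
  · simp [sumLT]
  · intro i j _
    rw [exchCoeff_swap, spinPerm_comm j i]
    module

/-- The product of two Dunkl operators, summed over the particles, on antisymmetric functions. -/
theorem IsAntisymm.sum_dunkl_dunkl {φ : SpinFun N twoM} (h : IsAntisymm φ) (p : Params)
    (u v : ℝ × ℝ × ℝ) {z : Pt N} (hz : Function.Injective z) (hφ : ContDiffAt ℝ 2 φ z) :
    ∑ i, dunkl p u i (dunkl p v i φ) z
      = ∑ i, onePart p u v (z i) (φ z) (pd i φ z) (pd i (pd i φ) z)
        + ∑ i, ∑ j ∈ Finset.univ.erase i, pairPart p u v (z i) (z j)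
            (φ z) (spinPerm i j (φ z)) (pd i φ z) (spinPerm i j (pd i φ z))
        + sumDistinct fun i j k =>
            (p.a ^ 2 * (exchCoeff u (z i) (z j) * exchCoeff v (z i) (z k))) •
              tripleSpin i j k (φ z) := by
  have hφ1 := hφ.differentiableAt two_ne_zero
  set y : Fin N → SpinSpace N twoM := fun i => dunkl p v i φ z with hy
  have h1 : ∀ i, dunkl p u i (dunkl p v i φ) z
      = weight u (z i) • pd i (dunkl p v i φ) z - ((p.m : ℝ) / 2 * weightDeriv u (z i)) • y i
        + p.a • ∑ j ∈ Finset.univ.erase i,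
            exchCoeff u (z i) (z j) • (y i + spinPerm i j (y j)) := by
    intro i
    rw [dunkl]
    congr 2
    refine Finset.sum_congr rfl fun j hj => ?_
    rw [K, h.dunkl_comp_swap p v (Finset.ne_of_mem_erase hj).symm hφ1, sub_neg_eq_add]
  have h2 : ∀ i, ∀ j, exchCoeff u (z i) (z j) • (y i - spinPerm i j (y i))
      = exchCoeff u (z i) (z j) • (weight v (z i) • (pd i φ z - spinPerm i j (pd i φ z))
          - ((p.m : ℝ) / 2 * weightDeriv v (z i)) • (φ z - spinPerm i j (φ z)))
        + ∑ k ∈ Finset.univ.erase i,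
            (p.a * (exchCoeff u (z i) (z j) * exchCoeff v (z i) (z k))) •
              tripleSpin i j k (φ z) := by
    intro i j
    simp only [mul_smul, ← Finset.smul_sum, tripleSpin, Finset.sum_sub_distrib, smul_sub, hy,
      h.dunkl_apply, map_add, map_sub, map_smul, map_sum]
    module
  simp only [h1, Finset.sum_add_distrib (f := fun i => _ - _), ← Finset.smul_sum]
  rw [sum_antisymm_coeff (fun i j => exchCoeff u (z i) (z j)) (fun i j => exchCoeff_swap _ _ _)]
  simp only [h2, Finset.sum_add_distrib (g := fun j => ∑ k ∈ Finset.univ.erase _, _)]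
  -- The diagonal `j = k` contributes nothing, since `(1 - S_ij)(1 + S_ij) = 0`.
  have h3 : ∀ i j : Fin N, tripleSpin i j j (φ z) = 0 := by
    intro i j
    rw [tripleSpin, map_add, spinPerm_self_apply]
    abel
  have h4 : p.a • sumDistinct (fun i j k =>
        (p.a * (exchCoeff u (z i) (z j) * exchCoeff v (z i) (z k))) • tripleSpin i j k (φ z))
      = sumDistinct fun i j k =>
          (p.a ^ 2 * (exchCoeff u (z i) (z j) * exchCoeff v (z i) (z k))) •
            tripleSpin i j k (φ z) := by
    rw [smul_sumDistinct]
    refine sumDistinct_congr fun i j k _ _ _ => ?_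
    module
  rw [sum_erase_erase]
  simp only [h3, smul_zero, Finset.sum_const_zero, zero_add]
  rw [smul_add, h4, ← add_assoc]
  congr 1
  simp only [Finset.smul_sum, ← Finset.sum_add_distrib]
  refine Finset.sum_congr rfl fun i _ => ?_
  have h5 : ∀ j, pairPart p u v (z i) (z j)
            (φ z) (spinPerm i j (φ z)) (pd i φ z) (spinPerm i j (pd i φ z))
      = (weight u (z i) * p.a) • (exchCoeff v (z i) (z j) • (pd i φ z + spinPerm i j (pd i φ z))
            + exchCoeffDeriv v (z i) (z j) • (φ z + spinPerm i j (φ z)))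
        - ((p.m : ℝ) / 2 * weightDeriv u (z i) * p.a) •
            (exchCoeff v (z i) (z j) • (φ z + spinPerm i j (φ z)))
        + p.a • (exchCoeff u (z i) (z j) • (weight v (z i) • (pd i φ z - spinPerm i j (pd i φ z))
          - ((p.m : ℝ) / 2 * weightDeriv v (z i)) • (φ z - spinPerm i j (φ z)))) := by
    intro j
    rw [pairPart]
    module
  simp only [h5, Finset.sum_add_distrib (f := fun i => _ - _), Finset.sum_sub_distrib,
    ← Finset.smul_sum, h.pd_dunkl p v i hz hφ, hy, h.dunkl_apply, onePart]
  module

/-! ### The gauge spin Hamiltonian on antisymmetric functions -/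

theorem eval_P (p : Params) (y : ℝ) : (P p).eval y
    = p.cpp * y ^ 4 + p.c0p * y ^ 3 + p.c00 * y ^ 2 + p.c0m * y + p.cmm := by
  simp [P]

theorem eval_derivative_P (p : Params) (y : ℝ) : (P p).derivative.eval y
    = 4 * p.cpp * y ^ 3 + 3 * p.c0p * y ^ 2 + 2 * p.c00 * y + p.c0m := by
  simp [P]
  ring

theorem eval_Qt (p : Params) (y : ℝ) : (Qt N p).eval y
    = p.cp * y ^ 2 + p.c0 * y + p.cm + (1 - b N p / 2) * (P p).derivative.eval y := by
  simp [Qt, Q]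

/-- If the coefficients `c i j k` are symmetric in `j, k` and their cyclic sums are all equal to
`κ`, they may be replaced by `κ / 3`: the symmetrization of `(1 - S_ij)(1 + S_ik)` in `j, k`
involves only the sum of the two three-cycles of `i, j, k`. -/
theorem sumDistinct_tripleSpin (c : Fin N → Fin N → Fin N → ℝ) (κ : ℝ)
    (hsymm : ∀ i j k, c i k j = c i j k)
    (hcyc : ∀ i j k, i ≠ j → j ≠ k → k ≠ i → c i j k + c j k i + c k i j = κ)
    (v : SpinSpace N twoM) :
    sumDistinct (fun i j k => c i j k • tripleSpin i j k v)
      = (κ / 3) • sumDistinct fun i j k => v - spinPerm i j (spinPerm i k v) := by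
  set U : Fin N → Fin N → Fin N → SpinSpace N twoM := fun i j k =>
    (2 : ℝ) • v - spinPerm i j (spinPerm i k v) - spinPerm i k (spinPerm i j v) with hU
  -- `U i j k` is `2 v` minus the sum of the two three-cycles applied to `v`, hence invariant.
  have hrot : ∀ i j k, i ≠ j → j ≠ k → k ≠ i → U j k i = U i j k := by
    intro i j k hij hjk hki
    have h1 : spinPerm j k (spinPerm j i v) = spinPerm i j (spinPerm i k v) := by
      rw [spinPerm_comm j i, spinPerm_spinPerm i j j k, Equiv.swap_apply_right,
        Equiv.swap_apply_of_ne_of_ne hki hjk.symm]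
    have h2 : spinPerm j i (spinPerm j k v) = spinPerm i k (spinPerm i j v) := by
      rw [spinPerm_spinPerm j k j i, Equiv.swap_apply_left,
        Equiv.swap_apply_of_ne_of_ne hij hki.symm, spinPerm_comm k i,
        spinPerm_spinPerm i k j k, Equiv.swap_apply_right,
        Equiv.swap_apply_of_ne_of_ne hij.symm hjk, spinPerm_comm j i]
    simp only [hU, h1, h2]
  have hA : (2 : ℝ) • sumDistinct (fun i j k => c i j k • tripleSpin i j k v)
      = sumDistinct fun i j k => c i j k • U i j k := by
    rw [two_smul]
    nth_rewrite 2 [sumDistinct_swap]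
    rw [← sumDistinct_add]
    refine sumDistinct_congr fun i j k _ _ _ => ?_
    simp only [hsymm i j k, hU, tripleSpin, map_add]
    module
  have hB : (3 : ℝ) • sumDistinct (fun i j k => c i j k • U i j k) = κ • sumDistinct U := by
    -- Average over the three cyclic permutations of the summation indices.
    have h3 : (3 : ℝ) = 1 + 1 + 1 := by norm_num
    rw [h3, add_smul, add_smul, one_smul]
    nth_rewrite 2 [sumDistinct_rotate]
    nth_rewrite 3 [sumDistinct_rotate]
    nth_rewrite 3 [sumDistinct_rotate]
    rw [← sumDistinct_add, ← sumDistinct_add, smul_sumDistinct]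
    refine sumDistinct_congr fun i j k hij hjk hki => ?_
    rw [hrot i j k hij hjk hki, ← hrot k i j hki hij hjk, ← hcyc i j k hij hjk hki]
    module
  have hC : sumDistinct U
      = (2 : ℝ) • sumDistinct fun i j k => v - spinPerm i j (spinPerm i k v) := by
    rw [two_smul]
    nth_rewrite 3 [sumDistinct_swap]
    rw [← sumDistinct_add]
    refine sumDistinct_congr fun i j k _ _ _ => ?_
    simp only [hU]
    module
  have hD : sumDistinct (fun i j k => c i j k • tripleSpin i j k v)
      = (1 / 6 : ℝ) • (3 : ℝ) • (2 : ℝ) •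
          sumDistinct (fun i j k => c i j k • tripleSpin i j k v) := by module
  rw [hD, hA, hB, hC]
  module

section Combination
variable {V : Type*} [AddCommGroup V] [Module ℝ V]

/-- The combination of products of Dunkl operators in `-H*`, applied to any bilinear expression
in the two weights. -/
def quadComb (p : Params) (f : ℝ × ℝ × ℝ → ℝ × ℝ × ℝ → V) : V :=
  p.cpp • f (0, 0, 1) (0, 0, 1) + p.c00 • f (0, 1, 0) (0, 1, 0) + p.cmm • f (1, 0, 0) (1, 0, 0)
    + (p.c0p / 2) • (f (0, 1, 0) (0, 0, 1) + f (0, 0, 1) (0, 1, 0))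
    + (p.c0m / 2) • (f (0, 1, 0) (1, 0, 0) + f (1, 0, 0) (0, 1, 0))

theorem quadComb_add (p : Params) (f g : ℝ × ℝ × ℝ → ℝ × ℝ × ℝ → V) :
    quadComb p (fun u v => f u v + g u v) = quadComb p f + quadComb p g := by
  simp only [quadComb]
  module

theorem quadComb_sum (p : Params) {ι : Type*} (s : Finset ι)
    (f : ι → ℝ × ℝ × ℝ → ℝ × ℝ × ℝ → V) :
    quadComb p (fun u v => ∑ i ∈ s, f i u v) = ∑ i ∈ s, quadComb p (f i) := by
  simp only [quadComb, Finset.sum_add_distrib, Finset.smul_sum, smul_add]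

theorem quadComb_smul (p : Params) (f : ℝ × ℝ × ℝ → ℝ × ℝ × ℝ → ℝ) (v : V) :
    quadComb p (fun u w => f u w • v) = quadComb p f • v := by
  simp only [quadComb, smul_eq_mul]
  module

/-- The linear part of `-H*`. -/
def linComb (p : Params) (f : ℝ × ℝ × ℝ → V) : V :=
  p.cp • f (0, 0, 1) + p.c0 • f (0, 1, 0) + p.cm • f (1, 0, 0)

theorem linComb_sum (p : Params) {ι : Type*} (s : Finset ι) (f : ι → ℝ × ℝ × ℝ → V) :
    linComb p (fun u => ∑ i ∈ s, f i u) = ∑ i ∈ s, linComb p (f i) := by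
  simp only [linComb, Finset.sum_add_distrib, Finset.smul_sum]

/-- The one-particle terms of `-H*` are those of `-H̄`, apart from the contribution of
`b - (1 + m) = a (N - 1)`, which belongs to the two-particle terms. -/
theorem onePart_comb (p : Params) (x : ℝ) (F D D2 : V) :
    quadComb p (fun u v => onePart p u v x F D D2)
        + linComb p (fun w => weight w x • D - ((p.m : ℝ) / 2 * weightDeriv w x) • F)
      = (P p).eval x • D2 + (Qt N p).eval x • D + R N p x • F
        - (p.a * ((N : ℝ) - 1)) • (-((P p).derivative.eval x / 2) • D
          + (p.cpp * x ^ 2 + p.c0p * (1 - p.m / 2) * x + p.c00 / 2) • F) := by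
  simp only [quadComb, linComb, onePart, weight, weightDeriv, eval_Qt, eval_P, eval_derivative_P, R,
    b]
  match_scalars <;> ring

/-- The two-particle terms of `-H*`, symmetrized over the two particles, are those of `-H̄` together
with the share of each pair in `a (N - 1)`, the first summand. -/
theorem pairPart_comb (p : Params) {x y : ℝ} (hxy : x ≠ y) (F TF Dx Dy TDx TDy : V) :
    quadComb p (fun u v => pairPart p u v x y F TF Dx TDx)
        + quadComb p (fun u v => pairPart p u v y x F TF Dy TDy)
      = (p.a • (-((P p).derivative.eval x / 2) • Dx
          + (p.cpp * x ^ 2 + p.c0p * (1 - p.m / 2) * x + p.c00 / 2) • F)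
        + p.a • (-((P p).derivative.eval y / 2) • Dy
          + (p.cpp * y ^ 2 + p.c0p * (1 - p.m / 2) * y + p.c00 / 2) • F))
        + (2 * p.a * p.cpp * (1 - (p.m : ℝ)) * (x * y)) • F
        + (2 * p.a) • ((1 / (x - y)) • ((P p).eval x • Dx - (P p).eval y • Dy))
        - p.a • ((((P p).eval x + (P p).eval y) / (x - y) ^ 2) • (F + TF))
        + p.a • ((p.cpp * (x + y) ^ 2 + p.c0p * (x + y) + p.c00) • TF) := by
  have h1 : x - y ≠ 0 := sub_ne_zero.2 hxy
  have h2 : y - x ≠ 0 := sub_ne_zero.2 hxy.symm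
  have h3 : (y - x) ^ 2 = (x - y) ^ 2 := by ring
  simp only [quadComb, pairPart, exchCoeffDeriv, h3, exchCoeff, weightPolar, weight,
    weightDeriv, eval_P, eval_derivative_P]
  match_scalars <;> field_simp <;> ring

end Combination

/-- The coefficients of the three-particle terms have constant cyclic sums: those of all products
of weights other than `J⁰ J⁰` cancel. -/
theorem exchCoeff_cyclic (p : Params) {x y z : ℝ} (hxy : x ≠ y) (hyz : y ≠ z) (hzx : z ≠ x) :
    quadComb p (fun u v => exchCoeff u x y * exchCoeff v x z)
      + quadComb p (fun u v => exchCoeff u y z * exchCoeff v y x)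
      + quadComb p (fun u v => exchCoeff u z x * exchCoeff v z y) = p.c00 / 4 := by
  have h1 : x - y ≠ 0 := sub_ne_zero.2 hxy
  have h2 : y - z ≠ 0 := sub_ne_zero.2 hyz
  have h3 : z - x ≠ 0 := sub_ne_zero.2 hzx
  have h4 : y - x ≠ 0 := sub_ne_zero.2 hxy.symm
  have h5 : z - y ≠ 0 := sub_ne_zero.2 hyz.symm
  have h6 : x - z ≠ 0 := sub_ne_zero.2 hzx.symm
  simp only [quadComb, exchCoeff, weightPolar, smul_eq_mul]
  field_simp
  ring

theorem Hstar_eq (p : Params) (φ : SpinFun N twoM) (z : Pt N) :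
    Hstar p φ z = -(quadComb p (fun u v => ∑ i, dunkl p u i (dunkl p v i φ) z)
      + linComb p (fun w => ∑ i, dunkl p w i φ z)) := by
  rw [quadComb_sum, linComb_sum, ← Finset.sum_add_distrib, Hstar]
  congr 1
  refine Finset.sum_congr rfl fun i _ => ?_
  simp only [Jminus_eq_dunkl, Jzero_eq_dunkl, Jplus_eq_dunkl, quadComb, linComb]
  abel

/-- On antisymmetric functions the operator `H*` acts as the gauge spin Hamiltonian. -/
theorem IsAntisymm.Hstar_eq_Hbar {φ : SpinFun N twoM} (h : IsAntisymm φ) (p : Params) {z : Pt N}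
    (hz : Function.Injective z) (hφ : ContDiffAt ℝ 2 φ z) : Hstar p φ z = Hbar p φ z := by
  rw [Hstar_eq, Hbar]
  congr 1
  simp only [h.sum_dunkl, h.sum_dunkl_dunkl p _ _ hz hφ, quadComb_add]
  have htriple : quadComb p (fun u v => sumDistinct fun i j k =>
        (p.a ^ 2 * (exchCoeff u (z i) (z j) * exchCoeff v (z i) (z k))) • tripleSpin i j k (φ z))
      = (p.a ^ 2 / 12 * p.c00) •
        (sumDistinct fun i j k => (1 - S twoM i j * S twoM i k) *ᵥ φ z) := by
    simp only [sumDistinct, quadComb_sum, quadComb_smul]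
    have h1 := sumDistinct_tripleSpin (fun i j k => quadComb p fun u v =>
      p.a ^ 2 * (exchCoeff u (z i) (z j) * exchCoeff v (z i) (z k))) (p.a ^ 2 * (p.c00 / 4))
      (fun i j k => by simp only [quadComb, smul_eq_mul]; ring)
      (fun i j k hij hjk hki => by
        rw [← exchCoeff_cyclic p (hz.ne hij) (hz.ne hjk) (hz.ne hki)]
        simp only [quadComb, smul_eq_mul]
        ring) (φ z)
    simp only [sumDistinct] at h1
    rw [h1]
    simp only [Matrix.sub_mulVec, Matrix.one_mulVec, ← Matrix.mulVec_mulVec, S_mulVec]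
    congr 1
    ring
  rw [htriple, add_right_comm]
  congr 1
  -- The factor `N - 1` counts the partners of each particle.
  have hone : ∀ F : Fin N → SpinSpace N twoM, (p.a * ((N : ℝ) - 1)) • ∑ i, F i
      = sumLT fun i j => p.a • F i + p.a • F j := by
    intro F
    rw [mul_smul, ← sum_erase_const, sum_erase_eq_sumLT, smul_sumLT]
    simp only [smul_add]
  rw [quadComb_sum, linComb_sum, add_right_comm, ← Finset.sum_add_distrib]
  simp only [onePart_comb (N := N), Finset.sum_sub_distrib, quadComb_sum, ← Finset.smul_sum, hone]
  have hpair := sumLT_congr fun i j (hij : i ≠ j) =>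
    pairPart_comb p (hz.ne hij) (φ z) (spinPerm i j (φ z)) (pd i φ z) (pd j φ z)
      (spinPerm i j (pd i φ z)) (spinPerm i j (pd j φ z))
  have hcomm : ∀ i j, quadComb p (fun u v => pairPart p u v (z j) (z i) (φ z)
        (spinPerm j i (φ z)) (pd j φ z) (spinPerm j i (pd j φ z)))
      = quadComb p (fun u v => pairPart p u v (z j) (z i) (φ z)
        (spinPerm i j (φ z)) (pd j φ z) (spinPerm i j (pd j φ z))) := by
    intro i j
    rw [spinPerm_comm j i]
  rw [sum_erase_eq_sumLT]
  simp only [hcomm]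
  rw [hpair]
  simp only [sumLT_add, sumLT_sub, ← smul_sumLT, ← sumLT_smul, Matrix.add_mulVec,
    Matrix.one_mulVec, S_mulVec]
  have hzz : sumLT (fun i j => 2 * p.a * p.cpp * (1 - (p.m : ℝ)) * (z i * z j))
      = 2 * p.a * p.cpp * (1 - (p.m : ℝ)) * sumLT fun i j => z i * z j :=
    (smul_sumLT (V := ℝ) _ _).symm
  rw [hzz]
  abel

/-! ### Primitives on an open interval and the change of variables -/

section Primitive
variable {J : Set ℝ} {c : ℝ} {f : ℝ → ℝ}

theorem hasDerivAt_primitive (hJ : IsOpen J) (hJc : J.OrdConnected) (hc : c ∈ J)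
    (hf : ContinuousOn f J) {y : ℝ} (hy : y ∈ J) :
    HasDerivAt (fun y => ∫ u in c..y, f u) (f y) y := by
  have hsub : Set.uIcc c y ⊆ J := hJc.uIcc_subset hc hy
  have hcont : ContinuousAt f y := hf.continuousAt (hJ.mem_nhds hy)
  exact intervalIntegral.integral_hasDerivAt_right (hf.mono hsub).intervalIntegrable
    (hf.stronglyMeasurableAtFilter hJ y hy) hcont

theorem contDiffOn_primitive (hJ : IsOpen J) (hJc : J.OrdConnected) (hc : c ∈ J)
    (hf : ContDiffOn ℝ ∞ f J) : ContDiffOn ℝ ∞ (fun y => ∫ u in c..y, f u) J := by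
  rw [contDiffOn_infty_iff_deriv_of_isOpen hJ]
  have h := fun y (hy : y ∈ J) => hasDerivAt_primitive hJ hJc hc hf.continuousOn hy
  exact ⟨fun y hy => (h y hy).differentiableAt.differentiableWithinAt,
    hf.congr fun y hy => (h y hy).deriv⟩

end Primitive

section Chi
variable {p : Params} {J : Set ℝ} {c τ : ℝ}

theorem contDiff_eval (q : Polynomial ℝ) : ContDiff ℝ ∞ fun y => q.eval y := by
  simpa using q.contDiff_aeval (𝕜 := ℝ) ∞

theorem contDiffOn_one_div_sqrt_P (hP : ∀ y ∈ J, 0 < (P p).eval y) :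
    ContDiffOn ℝ ∞ (fun y => 1 / √((P p).eval y)) J :=
  contDiffOn_const.div ((contDiff_eval _).contDiffOn.sqrt fun y hy => (hP y hy).ne')
    fun y hy => (Real.sqrt_pos.2 (hP y hy)).ne'

theorem hasDerivAt_chi (hJ : IsOpen J) (hJc : J.OrdConnected) (hc : c ∈ J)
    (hP : ∀ y ∈ J, 0 < (P p).eval y) {y : ℝ} (hy : y ∈ J) :
    HasDerivAt (chi p c τ) (1 / √((P p).eval y)) y :=
  (hasDerivAt_primitive hJ hJc hc (contDiffOn_one_div_sqrt_P hP).continuousOn hy).const_add τ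

theorem contDiffOn_chi (hJ : IsOpen J) (hJc : J.OrdConnected) (hc : c ∈ J)
    (hP : ∀ y ∈ J, 0 < (P p).eval y) : ContDiffOn ℝ ∞ (chi p c τ) J :=
  contDiffOn_const.add (contDiffOn_primitive hJ hJc hc (contDiffOn_one_div_sqrt_P hP))

theorem injOn_chi (hJ : IsOpen J) (hJc : J.OrdConnected) (hc : c ∈ J)
    (hP : ∀ y ∈ J, 0 < (P p).eval y) : Set.InjOn (chi p c τ) J := by
  refine (strictMonoOn_of_deriv_pos hJc.convex (contDiffOn_chi hJ hJc hc hP).continuousOn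
    fun y hy => ?_).injOn
  have hy := interior_subset hy
  rw [(hasDerivAt_chi hJ hJc hc hP hy).deriv]
  exact one_div_pos.2 (Real.sqrt_pos.2 (hP y hy))

theorem isOpen_image_chi (hJ : IsOpen J) (hJc : J.OrdConnected) (hc : c ∈ J)
    (hP : ∀ y ∈ J, 0 < (P p).eval y) {s : Set ℝ} (hs : IsOpen s) (hsJ : s ⊆ J) :
    IsOpen (chi p c τ '' s) := by
  rw [isOpen_iff_mem_nhds]
  rintro _ ⟨y, hy, rfl⟩
  have h1 : HasStrictDerivAt (chi p c τ) (1 / √((P p).eval y)) y :=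
    ((contDiffOn_chi hJ hJc hc hP).contDiffAt (hJ.mem_nhds (hsJ hy))).hasStrictDerivAt'
      (hasDerivAt_chi hJ hJc hc hP (hsJ hy)) (by simp)
  rw [← h1.map_nhds_eq (one_div_pos.2 (Real.sqrt_pos.2 (hP y (hsJ hy)))).ne']
  exact Filter.image_mem_map (hs.mem_nhds hy)

theorem contDiffOn_zeta (hJ : IsOpen J) (hJc : J.OrdConnected) (hc : c ∈ J)
    (hP : ∀ y ∈ J, 0 < (P p).eval y) : ContDiffOn ℝ ∞ (zeta p J c τ) (chi p c τ '' J) := by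
  have hinj := injOn_chi (τ := τ) hJ hJc hc hP
  have hsymm : ∀ y ∈ J, zeta p J c τ (chi p c τ y) = y := fun y hy =>
    hinj.leftInvOn_invFunOn hy
  let e : OpenPartialHomeomorph ℝ ℝ :=
    { toFun := chi p c τ
      invFun := zeta p J c τ
      source := J
      target := chi p c τ '' J
      map_source' := fun y hy => ⟨y, hy, rfl⟩
      map_target' := by
        rintro _ ⟨y, hy, rfl⟩
        rwa [hsymm y hy]
      left_inv' := hsymm
      right_inv' := by
        rintro _ ⟨y, hy, rfl⟩
        rw [hsymm y hy]
      open_source := hJ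
      open_target := isOpen_image_chi hJ hJc hc hP hJ subset_rfl
      continuousOn_toFun := (contDiffOn_chi hJ hJc hc hP).continuousOn
      continuousOn_invFun := by
        rw [continuousOn_open_iff (isOpen_image_chi hJ hJc hc hP hJ subset_rfl)]
        intro t ht
        have h2 : chi p c τ '' J ∩ zeta p J c τ ⁻¹' t = chi p c τ '' (J ∩ t) := by
          ext x
          constructor
          · rintro ⟨⟨y, hy, rfl⟩, hx⟩
            rw [Set.mem_preimage, hsymm y hy] at hx
            exact ⟨y, ⟨hy, hx⟩, rfl⟩
          · rintro ⟨y, ⟨hy, hyt⟩, rfl⟩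
            refine ⟨⟨y, hy, rfl⟩, ?_⟩
            rwa [Set.mem_preimage, hsymm y hy]
        rw [h2]
        exact isOpen_image_chi hJ hJc hc hP (hJ.inter ht) Set.inter_subset_left }
  rintro _ ⟨y, hy, rfl⟩
  have h3 : e.symm (chi p c τ y) = y := hsymm y hy
  refine (e.contDiffAt_symm_deriv (n := ∞) (f₀' := 1 / √((P p).eval y))
    (one_div_pos.2 (Real.sqrt_pos.2 (hP y hy))).ne' ⟨y, hy, rfl⟩ ?_ ?_).contDiffWithinAt
  · rw [h3]
    exact hasDerivAt_chi hJ hJc hc hP hy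
  · rw [h3]
    exact (contDiffOn_chi hJ hJc hc hP).contDiffAt (hJ.mem_nhds hy)

end Chi

/-! ### The gauge factor -/

/-- The logarithm of the gauge factor `mu`. No absolute value is needed, as `Real.log` is even. -/
def gaugeLog (p : Params) (c : Fin N → ℝ) (z : Pt N) : ℝ :=
  (sumLT fun i j => p.a * Real.log (z i - z j))
    + ∑ i, (-(1 / 4) * Real.log ((P p).eval (z i))
      + ∫ u in (c i)..(z i), (Qt N p).eval u / (2 * (P p).eval u))

/-- The partial derivative `∂_i log μ` at the point `Function.update z i t`. -/
def gaugeGrad (p : Params) (z : Pt N) (i : Fin N) (t : ℝ) : ℝ :=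
  p.a * ∑ j ∈ Finset.univ.erase i, 1 / (t - z j)
    + ((Qt N p).eval t - (P p).derivative.eval t / 2) / (2 * (P p).eval t)

/-- The derivative of `gaugeGrad p z i`. -/
def gaugeGradDeriv (p : Params) (z : Pt N) (i : Fin N) (t : ℝ) : ℝ :=
  -(p.a * ∑ j ∈ Finset.univ.erase i, 1 / (t - z j) ^ 2)
    + (((Qt N p).derivative.eval t - (P p).derivative.derivative.eval t / 2) * (2 * (P p).eval t)
      - ((Qt N p).eval t - (P p).derivative.eval t / 2) * (2 * (P p).derivative.eval t))
      / (2 * (P p).eval t) ^ 2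

section Gauge
variable {p : Params} {I : Fin N → Set ℝ} {c τ : Fin N → ℝ}

theorem isOpen_zDom (hI : ∀ i, IsOpen (I i)) : IsOpen (zDom I) := by
  have h : zDom I = (⋂ i, {z : Pt N | z i ∈ I i}) ∩ ⋂ i, ⋂ j, {z : Pt N | i ≠ j → z i ≠ z j} := by
    ext z
    simp only [zDom, Set.mem_ofPred_eq, Set.mem_inter_iff, Set.mem_iInter]
    refine and_congr_right fun _ => ⟨fun h i j hij => h.ne hij, fun h i j hij => ?_⟩
    by_contra hne
    exact h i j hne hij
  rw [h]
  refine (isOpen_iInter_of_finite fun i => (hI i).preimage (continuous_apply i)).inter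
    (isOpen_iInter_of_finite fun i => isOpen_iInter_of_finite fun j => ?_)
  by_cases hij : i = j
  · simp [hij]
  · simp only [ne_eq, hij, not_false_eq_true, forall_const]
    exact isOpen_ne_fun (continuous_apply i) (continuous_apply j)

theorem mu_eq_exp (hP : ∀ i, ∀ y ∈ I i, 0 < (P p).eval y) {z : Pt N} (hz : z ∈ zDom I) :
    mu p c z = Real.exp (gaugeLog p c z) := by
  rw [mu, gaugeLog, Real.exp_add, sumLT, Real.exp_sum, Real.exp_sum]
  congr 1
  · refine Finset.prod_congr rfl fun i _ => ?_
    rw [Real.exp_sum]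
    refine Finset.prod_congr rfl fun j hj => ?_
    have hne : z i - z j ≠ 0 := sub_ne_zero.2 (hz.2.ne (Finset.mem_filter.1 hj).2.ne)
    rw [Real.rpow_def_of_pos (abs_pos.2 hne), Real.log_abs, mul_comm]
  · refine Finset.prod_congr rfl fun i _ => ?_
    rw [Real.exp_add, Real.rpow_def_of_pos (hP i _ (hz.1 i)), mul_comm (Real.log _)]

theorem contDiffOn_Qt_div (i : Fin N) (hP : ∀ y ∈ I i, 0 < (P p).eval y) :
    ContDiffOn ℝ ∞ (fun u => (Qt N p).eval u / (2 * (P p).eval u)) (I i) :=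
  (contDiff_eval _).contDiffOn.div (contDiff_const.mul (contDiff_eval _)).contDiffOn
    fun y hy => (mul_pos two_pos (hP y hy)).ne'

theorem contDiffOn_gaugeLog (hI : ∀ i, IsOpen (I i)) (hIc : ∀ i, (I i).OrdConnected)
    (hc : ∀ i, c i ∈ I i) (hP : ∀ i, ∀ y ∈ I i, 0 < (P p).eval y) :
    ContDiffOn ℝ ∞ (gaugeLog p c) (zDom I) := by
  have hproj : ∀ i, ContDiffOn ℝ ∞ (fun z : Pt N => z i) (zDom I) := fun i =>
    (contDiff_apply ℝ ℝ i).contDiffOn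
  refine ContDiffOn.add (ContDiffOn.sum fun i _ => ContDiffOn.sum fun j hj => ?_)
    (ContDiffOn.sum fun i _ => ContDiffOn.add ?_ ?_)
  · refine contDiffOn_const.mul (((hproj i).sub (hproj j)).log fun z hz => ?_)
    exact sub_ne_zero.2 (hz.2.ne (Finset.mem_filter.1 hj).2.ne)
  · refine contDiffOn_const.mul (((contDiff_eval (P p)).comp_contDiffOn (hproj i)).log
      fun z hz => (hP i _ (hz.1 i)).ne')
  · exact (contDiffOn_primitive (hI i) (hIc i) (hc i) (contDiffOn_Qt_div i (hP i))).comp (hproj i)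
      fun z hz => hz.1 i

theorem hasDerivAt_gaugeLog (hI : ∀ i, IsOpen (I i)) (hIc : ∀ i, (I i).OrdConnected)
    (hc : ∀ i, c i ∈ I i) (hP : ∀ i, ∀ y ∈ I i, 0 < (P p).eval y) (i : Fin N) {z : Pt N}
    (hz : z ∈ zDom I) :
    HasDerivAt (fun t => gaugeLog p c (Function.update z i t)) (gaugeGrad p z i (z i)) (z i) := by
  -- `δ k` is the derivative of the `k`-th coordinate along the line.
  set δ : Fin N → ℝ := Pi.single i 1 with hδ
  have hproj : ∀ k, HasDerivAt (fun t => Function.update z i t k) (δ k) (z i) := fun k =>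
    hasDerivAt_pi.1 (hasDerivAt_update z i (z i)) k
  have hself : ∀ k, Function.update z i (z i) k = z k := fun k => by
    rw [Function.update_eq_self]
  have h1 : HasDerivAt
      (fun t => sumLT fun k l => p.a * Real.log (Function.update z i t k - Function.update z i t l))
      (sumLT fun k l => p.a * ((δ k - δ l) / (z k - z l))) (z i) := by
    refine HasDerivAt.fun_sum fun k _ => HasDerivAt.fun_sum fun l hl => ?_
    have hne : z k - z l ≠ 0 := sub_ne_zero.2 (hz.2.ne (Finset.mem_filter.1 hl).2.ne)
    have h := (((hproj k).fun_sub (hproj l)).log (by simpa only [hself] using hne)).const_mul p.a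
    simpa only [hself, Pi.sub_apply] using h
  have h2 : HasDerivAt (fun t => ∑ k, (-(1 / 4) * Real.log ((P p).eval (Function.update z i t k))
      + ∫ u in (c k)..(Function.update z i t k), (Qt N p).eval u / (2 * (P p).eval u)))
      (∑ k, (-(1 / 4) * ((P p).derivative.eval (z k) * δ k / (P p).eval (z k))
        + (Qt N p).eval (z k) / (2 * (P p).eval (z k)) * δ k)) (z i) := by
    refine HasDerivAt.fun_sum fun k _ => ?_
    have hPk := hP k _ (hz.1 k)
    have e1 : HasDerivAt (fun t => (P p).eval (Function.update z i t k))
        ((P p).derivative.eval (z k) * δ k) (z i) :=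
      HasDerivAt.comp_of_eq (z i) ((P p).hasDerivAt (z k)) (hproj k) (hself k).symm
    have e2 := (e1.log (by rw [hself]; exact hPk.ne')).const_mul (-(1 / 4))
    have e3 : HasDerivAt (fun t => ∫ u in (c k)..(Function.update z i t k),
        (Qt N p).eval u / (2 * (P p).eval u))
        ((Qt N p).eval (z k) / (2 * (P p).eval (z k)) * δ k) (z i) :=
      HasDerivAt.comp_of_eq (z i) (hasDerivAt_primitive (hI k) (hIc k) (hc k)
        (contDiffOn_Qt_div k (hP k)).continuousOn (hz.1 k)) (hproj k) (hself k).symm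
    simpa only [hself] using e2.fun_add e3
  refine (h1.add h2).congr_deriv ?_
  have h3 : (sumLT fun k l => p.a * ((δ k - δ l) / (z k - z l)))
      = p.a * ∑ j ∈ Finset.univ.erase i, 1 / (z i - z j) := by
    have h := sum_erase_eq_sumLT fun k l => p.a * (δ k / (z k - z l))
    rw [sumLT_congr (g := fun k l => p.a * (δ k / (z k - z l)) + p.a * (δ l / (z l - z k))), ← h,
      Finset.sum_eq_single i]
    · simp [hδ, Finset.mul_sum]
    · intro k _ hk
      simp [hδ, hk]
    · simp
    · intro k l _
      rw [← neg_sub (z k) (z l), div_neg]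
      ring
  have h4 : (∑ k, (-(1 / 4) * ((P p).derivative.eval (z k) * δ k / (P p).eval (z k))
        + (Qt N p).eval (z k) / (2 * (P p).eval (z k)) * δ k))
      = ((Qt N p).eval (z i) - (P p).derivative.eval (z i) / 2) / (2 * (P p).eval (z i)) := by
    have hPi := (hP i _ (hz.1 i)).ne'
    rw [Finset.sum_eq_single i]
    · simp only [hδ, Pi.single_eq_same]
      field_simp
      ring
    · intro k _ hk
      simp [hδ, hk]
    · simp
  rw [h3, h4, gaugeGrad]

theorem hasDerivAt_gaugeGrad (hP : ∀ i, ∀ y ∈ I i, 0 < (P p).eval y) (i : Fin N) {z : Pt N}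
    (hz : z ∈ zDom I) :
    HasDerivAt (gaugeGrad p z i) (gaugeGradDeriv p z i (z i)) (z i) := by
  have h1 : HasDerivAt (fun t => p.a * ∑ j ∈ Finset.univ.erase i, 1 / (t - z j))
      (-(p.a * ∑ j ∈ Finset.univ.erase i, 1 / (z i - z j) ^ 2)) (z i) := by
    rw [← mul_neg, ← Finset.sum_neg_distrib]
    refine (HasDerivAt.fun_sum fun j hj => ?_).const_mul _
    have hne : z i - z j ≠ 0 := sub_ne_zero.2 (hz.2.ne (Finset.ne_of_mem_erase hj).symm)
    simpa only [one_div, neg_div] using ((hasDerivAt_id' (z i)).sub_const (z j)).fun_inv hne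
  have h2 := (((Qt N p).hasDerivAt (z i)).sub (((P p).derivative.hasDerivAt (z i)).div_const 2)).div
    (((P p).hasDerivAt (z i)).const_mul 2) (mul_pos two_pos (hP i _ (hz.1 i))).ne'
  exact h1.add h2

end Gauge

/-! ### Conjugation by the gauge factor -/

section OneVariable
variable {V : Type*} [NormedAddCommGroup V] [NormedSpace ℝ V]

/-- The first two derivatives of `exp (-L) • (g ∘ χ)` at `t`, in terms of those of `g`, where
`L' = G` and `χ' = r`. -/
theorem deriv_gauge {L χ G r : ℝ → ℝ} {g : ℝ → V} {t G' r' : ℝ}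
    (hL : ∀ᶠ s in nhds t, HasDerivAt L (G s) s) (hG : HasDerivAt G G' t)
    (hχ : ∀ᶠ s in nhds t, HasDerivAt χ (r s) s) (hr : HasDerivAt r r' t)
    (hg : ContDiffAt ℝ 2 g (χ t)) {f : ℝ → V}
    (hf : ∀ᶠ s in nhds t, f s = Real.exp (-L s) • g (χ s)) :
    deriv f t = Real.exp (-L t) • (r t • deriv g (χ t) - G t • g (χ t)) ∧
    deriv (deriv f) t = Real.exp (-L t) • ((r t ^ 2) • deriv (deriv g) (χ t)
      + (r' - 2 * G t * r t) • deriv g (χ t) + (G t ^ 2 - G') • g (χ t)) := by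
  have hg1 : ∀ᶠ s in nhds t, HasDerivAt g (deriv g (χ s)) (χ s) := by
    have h : ∀ᶠ y in nhds (χ t), HasDerivAt g (deriv g y) y :=
      (hg.eventually (by simp)).mono fun y hy => (hy.differentiableAt two_ne_zero).hasDerivAt
    exact hχ.self_of_nhds.continuousAt.eventually h
  have hg2 : HasDerivAt (deriv g) (deriv (deriv g) (χ t)) (χ t) :=
    (((hg.fderiv_right (m := 1) (by norm_num)).differentiableAt one_ne_zero).clm_apply
      (differentiableAt_const 1)).hasDerivAt
  have h1 : ∀ᶠ s in nhds t, HasDerivAt f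
      (Real.exp (-L s) • (r s • deriv g (χ s) - G s • g (χ s))) s := by
    filter_upwards [hL, hχ, hg1, hf.eventually_nhds] with s hLs hχs hgs hfs
    refine HasDerivAt.congr_of_eventuallyEq ?_ hfs
    refine (hLs.fun_neg.exp.smul (hgs.scomp s hχs)).congr_deriv ?_
    simp only [Function.comp_apply]
    module
  refine ⟨h1.self_of_nhds.deriv, ?_⟩
  rw [Filter.EventuallyEq.deriv_eq (h1.mono fun s hs => hs.deriv)]
  have hLt := hL.self_of_nhds
  have hχt := hχ.self_of_nhds
  have h2 := hLt.fun_neg.exp.smul ((hr.smul (hg2.scomp t hχt)).sub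
    (hG.smul (hg1.self_of_nhds.scomp t hχt)))
  refine h2.deriv.trans ?_
  simp only [Function.comp_apply, Pi.sub_apply, Pi.smul_apply']
  module

end OneVariable

section Gauge
variable {p : Params} {I : Fin N → Set ℝ} {c τ : Fin N → ℝ}

theorem chiMap_update (z : Pt N) (i : Fin N) (t : ℝ) :
    chiMap p c τ (Function.update z i t)
      = Function.update (chiMap p c τ z) i (chi p (c i) (τ i) t) := by
  ext k
  rcases eq_or_ne k i with rfl | hk
  · simp [chiMap]
  · simp [chiMap, hk]

theorem gaugeGrad_update (z : Pt N) (i : Fin N) (s t : ℝ) :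
    gaugeGrad p (Function.update z i s) i t = gaugeGrad p z i t := by
  rw [gaugeGrad, gaugeGrad]
  congr 2
  refine Finset.sum_congr rfl fun j hj => ?_
  rw [Function.update_of_ne (Finset.ne_of_mem_erase hj)]

theorem hasDerivAt_one_div_sqrt_P {y : ℝ} (hy : 0 < (P p).eval y) :
    HasDerivAt (fun y => 1 / √((P p).eval y))
      (-((P p).derivative.eval y / (2 * (P p).eval y)) * (1 / √((P p).eval y))) y := by
  have h := (((P p).hasDerivAt y).sqrt hy.ne').fun_inv (Real.sqrt_pos.2 hy).ne'
  simp only [one_div]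
  refine h.congr_deriv ?_
  have hs := (Real.sqrt_pos.2 hy).ne'
  rw [Real.sq_sqrt hy.le]
  field_simp

/-- The first two partial derivatives of `μ⁻¹ (ψ ∘ χ)`. -/
theorem pd_gauge (hI : ∀ i, IsOpen (I i)) (hIc : ∀ i, (I i).OrdConnected)
    (hc : ∀ i, c i ∈ I i) (hP : ∀ i, ∀ y ∈ I i, 0 < (P p).eval y) (i : Fin N) {z : Pt N}
    (hz : z ∈ zDom I) {ψ : SpinFun N twoM} (hψ : ContDiffAt ℝ 2 ψ (chiMap p c τ z)) :
    pd i (fun z => (mu p c z)⁻¹ • ψ (chiMap p c τ z)) z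
      = Real.exp (-gaugeLog p c z) • ((1 / √((P p).eval (z i))) • pd i ψ (chiMap p c τ z)
        - gaugeGrad p z i (z i) • ψ (chiMap p c τ z)) ∧
    pd i (pd i (fun z => (mu p c z)⁻¹ • ψ (chiMap p c τ z))) z
      = Real.exp (-gaugeLog p c z) •
        ((1 / (P p).eval (z i)) • pd i (pd i ψ) (chiMap p c τ z)
        + (-((P p).derivative.eval (z i) / (2 * (P p).eval (z i))) * (1 / √((P p).eval (z i)))
          - 2 * gaugeGrad p z i (z i) * (1 / √((P p).eval (z i)))) • pd i ψ (chiMap p c τ z)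
        + (gaugeGrad p z i (z i) ^ 2 - gaugeGradDeriv p z i (z i)) • ψ (chiMap p c τ z)) := by
  have hPi := hP i _ (hz.1 i)
  have hline : ∀ᶠ t in nhds (z i), Function.update z i t ∈ zDom I := by
    have h : ContinuousAt (Function.update z i) (z i) :=
      (hasDerivAt_update z i (z i)).continuousAt
    refine h.eventually ?_
    rw [Function.update_eq_self]
    exact (isOpen_zDom hI).mem_nhds hz
  have hL : ∀ᶠ t in nhds (z i), HasDerivAt (fun t => gaugeLog p c (Function.update z i t))
      (gaugeGrad p z i t) t := by
    filter_upwards [hline] with t ht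
    have h := hasDerivAt_gaugeLog hI hIc hc hP i ht
    simpa only [Function.update_idem, Function.update_self, gaugeGrad_update] using h
  have hχ : ∀ᶠ t in nhds (z i), HasDerivAt (chi p (c i) (τ i)) (1 / √((P p).eval t)) t := by
    filter_upwards [(hI i).mem_nhds (hz.1 i)] with t ht
    exact hasDerivAt_chi (hI i) (hIc i) (hc i) (hP i) ht
  have hg : ContDiffAt ℝ 2 (fun s : ℝ => ψ (Function.update (chiMap p c τ z) i s))
      (chi p (c i) (τ i) (z i)) := by
    refine ContDiffAt.comp _ (g := ψ) (f := Function.update (chiMap p c τ z) i) ?_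
      (contDiff_update 2 _ i).contDiffAt
    rwa [← chiMap_update, Function.update_eq_self]
  have hf : ∀ᶠ t in nhds (z i),
      (mu p c (Function.update z i t))⁻¹ • ψ (chiMap p c τ (Function.update z i t))
        = Real.exp (-gaugeLog p c (Function.update z i t)) •
          ψ (Function.update (chiMap p c τ z) i (chi p (c i) (τ i) t)) := by
    filter_upwards [hline] with t ht
    rw [mu_eq_exp hP ht, Real.exp_neg, chiMap_update]
  have h := deriv_gauge hL (hasDerivAt_gaugeGrad hP i hz) hχ (hasDerivAt_one_div_sqrt_P hPi) hg hf
  have hpd : ∀ φ : SpinFun N twoM, ∀ y, pd i (pd i φ) y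
      = deriv (deriv fun t => φ (Function.update y i t)) (y i) := by
    intro φ y
    rw [pd]
    congr 1
    exact funext fun t => pd_update i φ y t
  rw [hpd, hpd]
  simpa only [Function.update_eq_self, ← chiMap_update, pd, chiMap, div_pow, one_pow,
    Real.sq_sqrt hPi.le] using h

/-- The scalar that conjugation by `μ` leaves at the `i`-th particle, in place of the first-order
terms and of `R`, written as in the potential. -/
theorem gauge_scalar (hP : ∀ i, ∀ y ∈ I i, 0 < (P p).eval y) (i : Fin N) {z : Pt N}
    (hz : z ∈ zDom I) :
    (P p).eval (z i) * gaugeGrad p z i (z i) ^ 2 + (P p).eval (z i) * gaugeGradDeriv p z i (z i)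
        + (P p).derivative.eval (z i) / 2 * gaugeGrad p z i (z i) - R N p (z i)
      = p.a ^ 2 * (∑ j ∈ Finset.univ.erase i, ∑ k ∈ Finset.univ.erase i,
            (P p).eval (z i) / ((z i - z j) * (z i - z k)))
        + p.a * ∑ j ∈ Finset.univ.erase i, (Qt N p).eval (z i) / (z i - z j)
        - p.a * ∑ j ∈ Finset.univ.erase i, (P p).eval (z i) / (z i - z j) ^ 2
        + 1 / 4 * (1 / (P p).eval (z i) *
          (3 / 4 * (P p).derivative.eval (z i) ^ 2 + (Qt N p).eval (z i) ^ 2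
            - 2 * (Qt N p).eval (z i) * (P p).derivative.eval (z i))
        - (P p).derivative.derivative.eval (z i) + 2 * (Qt N p).derivative.eval (z i)
        - 4 * R N p (z i)) := by
  have hPi := (hP i _ (hz.1 i)).ne'
  have h1 : (∑ j ∈ Finset.univ.erase i, ∑ k ∈ Finset.univ.erase i,
            (P p).eval (z i) / ((z i - z j) * (z i - z k)))
      = (P p).eval (z i) * (∑ j ∈ Finset.univ.erase i, 1 / (z i - z j)) ^ 2 := by
    rw [sq, Finset.sum_mul_sum, Finset.mul_sum]
    refine Finset.sum_congr rfl fun j _ => ?_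
    rw [Finset.mul_sum]
    refine Finset.sum_congr rfl fun k _ => ?_
    rw [one_div_mul_one_div, mul_one_div]
  have h2 : ∑ j ∈ Finset.univ.erase i, (Qt N p).eval (z i) / (z i - z j)
      = (Qt N p).eval (z i) * ∑ j ∈ Finset.univ.erase i, 1 / (z i - z j) := by
    rw [Finset.mul_sum]
    exact Finset.sum_congr rfl fun j _ => (mul_one_div _ _).symm
  have h3 : ∑ j ∈ Finset.univ.erase i, (P p).eval (z i) / (z i - z j) ^ 2
      = (P p).eval (z i) * ∑ j ∈ Finset.univ.erase i, 1 / (z i - z j) ^ 2 := by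
    rw [Finset.mul_sum]
    exact Finset.sum_congr rfl fun j _ => (mul_one_div _ _).symm
  rw [h1, h2, h3, gaugeGrad, gaugeGradDeriv]
  field_simp
  ring

/-- The action of the matrix potential on a spin vector. -/
theorem potZ_mulVec (p : Params) (z : Pt N) (v : SpinSpace N twoM) :
    potZ twoM p z *ᵥ v
      = (p.a ^ 2 * sumDistinct fun i j k =>
          (P p).eval (z i) / ((z i - z j) * (z i - z k))) • v
      + (p.a * ∑ i, ∑ j ∈ Finset.univ.erase i, (Qt N p).eval (z i) / (z i - z j)) • v
      + (p.a ^ 2 * sumLT fun i j => ((P p).eval (z i) + (P p).eval (z j)) / (z i - z j) ^ 2) • v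
      + p.a • (sumLT fun i j => (((P p).eval (z i) + (P p).eval (z j)) / (z i - z j) ^ 2) •
          spinPerm i j v)
      - (2 * p.a * p.cpp * (1 - (p.m : ℝ)) * sumLT fun i j => z i * z j) • v
      - p.a • (sumLT fun i j =>
          (p.cpp * (z i + z j) ^ 2 + p.c0p * (z i + z j) + p.c00) • spinPerm i j v)
      + (1 / 4 * ∑ i, (1 / (P p).eval (z i) *
          (3 / 4 * (P p).derivative.eval (z i) ^ 2 + (Qt N p).eval (z i) ^ 2
            - 2 * (Qt N p).eval (z i) * (P p).derivative.eval (z i))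
        - (P p).derivative.derivative.eval (z i) + 2 * (Qt N p).derivative.eval (z i)
        - 4 * R N p (z i))) • v
      - (p.a ^ 2 / 12 * p.c00) • (sumDistinct fun i j k => v - spinPerm i j (spinPerm i k v)) := by
  have hLT : ∀ f : Fin N → Fin N → SpinMat N twoM, sumLT f *ᵥ v = sumLT fun i j => f i j *ᵥ v :=
    fun f => by simp only [sumLT, Matrix.sum_mulVec]
  have hD : ∀ f : Fin N → Fin N → Fin N → SpinMat N twoM,
      sumDistinct f *ᵥ v = sumDistinct fun i j k => f i j k *ᵥ v :=
    fun f => by simp only [sumDistinct, Matrix.sum_mulVec]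
  have hsplit : p.a • (sumLT fun i j => (((P p).eval (z i) + (P p).eval (z j)) / (z i - z j) ^ 2) •
        (p.a • v + spinPerm i j v))
      = (p.a ^ 2 * sumLT fun i j => ((P p).eval (z i) + (P p).eval (z j)) / (z i - z j) ^ 2) • v
      + p.a • (sumLT fun i j => (((P p).eval (z i) + (P p).eval (z j)) / (z i - z j) ^ 2) •
          spinPerm i j v) := by
    have h : ∀ r : ℝ, r • p.a • v = p.a • r • v := fun r => smul_comm _ _ _
    simp only [smul_add, sumLT_add, h, ← smul_sumLT, ← sumLT_smul]
    module
  simp only [potZ, Matrix.add_mulVec, Matrix.sub_mulVec, Matrix.smul_mulVec, Matrix.one_mulVec,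
    hLT, hD, ← Matrix.mulVec_mulVec, S_mulVec, hsplit]
  abel

theorem potZ_isHermitian (p : Params) (z : Pt N) : (potZ twoM p z).IsHermitian := by
  have hr : ∀ (r : ℝ) {A : SpinMat N twoM}, A.IsHermitian → (r • A).IsHermitian := by
    intro r A hA
    rw [Matrix.IsHermitian, Matrix.conjTranspose_smul, hA, star_trivial]
  have hLT : ∀ f : Fin N → Fin N → SpinMat N twoM, (∀ i j, (f i j).IsHermitian) →
      (sumLT f).IsHermitian := by
    intro f hf
    simp only [Matrix.IsHermitian, sumLT, Matrix.conjTranspose_sum, fun i j => (hf i j).eq]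
  have hD : (sumDistinct fun i j k => 1 - S twoM i j * S twoM i k :
      SpinMat N twoM).IsHermitian := by
    have h : (sumDistinct fun i j k => 1 - S twoM i j * S twoM i k : SpinMat N twoM)ᴴ
        = sumDistinct fun i j k => 1 - S twoM i k * S twoM i j := by
      simp only [sumDistinct, Matrix.conjTranspose_sum, Matrix.conjTranspose_sub,
        Matrix.conjTranspose_one, Matrix.conjTranspose_mul, (S_isHermitian _ _).eq]
    rw [Matrix.IsHermitian, h]
    exact sumDistinct_swap fun i j k => (1 - S twoM i k * S twoM i j : SpinMat N twoM)
  have h1 : (1 : SpinMat N twoM).IsHermitian := Matrix.isHermitian_one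
  exact ((((((hr _ h1).add (hr _ h1)).add
    (hr _ (hLT _ fun i j => hr _ ((hr _ h1).add (S_isHermitian i j))))).sub (hr _ h1)).sub
    (hr _ (hLT _ fun i j => hr _ (S_isHermitian i j)))).add (hr _ h1)).sub (hr _ hD)

/-- The operator `Hbar` in terms of the values of a function and of its derivatives, with the
two-particle first-order terms collected at each particle. -/
theorem Hbar_eq (p : Params) (φ : SpinFun N twoM) (z : Pt N) :
    Hbar p φ z = -(∑ i, ((P p).eval (z i) • pd i (pd i φ) z
        + ((Qt N p).eval (z i) + 2 * p.a * (P p).eval (z i) *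
            ∑ j ∈ Finset.univ.erase i, 1 / (z i - z j)) • pd i φ z + R N p (z i) • φ z)
      + (2 * p.a * p.cpp * (1 - (p.m : ℝ)) * sumLT fun i j => z i * z j) • φ z
      - (p.a * ∑ i, ∑ j ∈ Finset.univ.erase i, (P p).eval (z i) / (z i - z j) ^ 2) • φ z
      - p.a • (sumLT fun i j => (((P p).eval (z i) + (P p).eval (z j)) / (z i - z j) ^ 2) •
          spinPerm i j (φ z))
      + p.a • (sumLT fun i j =>
          (p.cpp * (z i + z j) ^ 2 + p.c0p * (z i + z j) + p.c00) • spinPerm i j (φ z))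
      + (p.a ^ 2 / 12 * p.c00) •
          (sumDistinct fun i j k => φ z - spinPerm i j (spinPerm i k (φ z)))) := by
  have h1 : (2 * p.a) • (sumLT fun i j => (1 / (z i - z j)) •
        ((P p).eval (z i) • pd i φ z - (P p).eval (z j) • pd j φ z))
      = ∑ i, (2 * p.a * (P p).eval (z i) * ∑ j ∈ Finset.univ.erase i, 1 / (z i - z j)) •
          pd i φ z := by
    have h := sum_erase_eq_sumLT fun i j =>
      (2 * p.a * (P p).eval (z i) * (1 / (z i - z j))) • pd i φ z
    simp only [Finset.mul_sum, Finset.sum_smul]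
    rw [h, smul_sumLT]
    refine sumLT_congr fun i j _ => ?_
    rw [← neg_sub (z i) (z j), one_div_neg_eq_neg_one_div]
    module
  have h2 : (∑ i, ∑ j ∈ Finset.univ.erase i, (P p).eval (z i) / (z i - z j) ^ 2)
      = sumLT fun i j => ((P p).eval (z i) + (P p).eval (z j)) / (z i - z j) ^ 2 := by
    rw [sum_erase_eq_sumLT]
    refine sumLT_congr fun i j _ => ?_
    rw [← neg_sub (z i) (z j), neg_sq, ← add_div]
  rw [Hbar, h1, h2]
  simp only [Matrix.add_mulVec, Matrix.sub_mulVec, Matrix.one_mulVec, ← Matrix.mulVec_mulVec,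
    S_mulVec, add_smul, smul_add, sumLT_add, ← sumLT_smul, Finset.sum_add_distrib, mul_smul p.a]
  abel

theorem gaugeTransform_Hbar (hI : ∀ i, IsOpen (I i)) (hIc : ∀ i, (I i).OrdConnected)
    (hc : ∀ i, c i ∈ I i) (hP : ∀ i, ∀ y ∈ I i, 0 < (P p).eval y) {z : Pt N}
    (hz : z ∈ zDom I) {ψ : SpinFun N twoM} (hψ : ContDiffAt ℝ 2 ψ (chiMap p c τ z)) :
    mu p c z • Hbar p (fun z => (mu p c z)⁻¹ • ψ (chiMap p c τ z)) z
      = -∑ i, pd i (pd i ψ) (chiMap p c τ z) + potZ twoM p z *ᵥ ψ (chiMap p c τ z) := by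
  set F := ψ (chiMap p c τ z) with hF
  set E := Real.exp (-gaugeLog p c z) with hE
  have hμE : mu p c z * E = 1 := by
    rw [mu_eq_exp hP hz, hE, ← Real.exp_add, add_neg_cancel, Real.exp_zero]
  have hinv : (mu p c z)⁻¹ = E := (eq_inv_of_mul_eq_one_right hμE).symm
  -- The first-order terms cancel and the second-order coefficient becomes one.
  have hone : ∀ i, (P p).eval (z i) •
        pd i (pd i (fun z => (mu p c z)⁻¹ • ψ (chiMap p c τ z))) z
      + ((Qt N p).eval (z i) + 2 * p.a * (P p).eval (z i) *
          ∑ j ∈ Finset.univ.erase i, 1 / (z i - z j)) •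
        pd i (fun z => (mu p c z)⁻¹ • ψ (chiMap p c τ z)) z
      + R N p (z i) • (E • F)
      = E • (pd i (pd i ψ) (chiMap p c τ z)
        - ((P p).eval (z i) * gaugeGrad p z i (z i) ^ 2
          + (P p).eval (z i) * gaugeGradDeriv p z i (z i)
          + (P p).derivative.eval (z i) / 2 * gaugeGrad p z i (z i) - R N p (z i)) • F) := by
    intro i
    have hPi := (hP i _ (hz.1 i)).ne'
    have hA : (Qt N p).eval (z i) + 2 * p.a * (P p).eval (z i) *
          ∑ j ∈ Finset.univ.erase i, 1 / (z i - z j)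
        = 2 * (P p).eval (z i) * gaugeGrad p z i (z i) + (P p).derivative.eval (z i) / 2 := by
      rw [gaugeGrad]
      field_simp
      ring
    obtain ⟨h1, h2⟩ := pd_gauge hI hIc hc hP i hz hψ
    rw [h1, h2, hA]
    simp only [← hF, ← hE]
    match_scalars <;> field_simp <;> ring
  have hspin : ∀ (i j : Fin N) (v : SpinSpace N twoM),
      spinPerm i j (E • v) = E • spinPerm i j v := fun i j v => map_smul _ _ _
  have hD : (sumDistinct fun i j k => E • F - E • spinPerm i j (spinPerm i k F))
      = E • sumDistinct fun i j k => F - spinPerm i j (spinPerm i k F) := by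
    simp only [smul_sumDistinct, smul_sub]
  have hLT : ∀ (g : Fin N → Fin N → ℝ) (f : Fin N → Fin N → SpinSpace N twoM),
      sumLT (fun i j => g i j • E • f i j) = E • sumLT fun i j => g i j • f i j := fun g f => by
    rw [smul_sumLT]
    exact sumLT_congr fun i j _ => smul_comm _ _ _
  rw [Hbar_eq, potZ_mulVec]
  simp only [← hF, hinv] at hone ⊢
  simp only [hone, hspin, hLT, hD, ← Finset.smul_sum]
  simp only [gauge_scalar hP _ hz, Finset.sum_sub_distrib, ← Finset.sum_smul,
    Finset.sum_add_distrib, ← Finset.mul_sum]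
  rw [sum_erase_erase]
  have h2 : (∑ i, ∑ j ∈ Finset.univ.erase i, (P p).eval (z i) / ((z i - z j) * (z i - z j)))
      = sumLT fun i j => ((P p).eval (z i) + (P p).eval (z j)) / (z i - z j) ^ 2 := by
    rw [sum_erase_eq_sumLT]
    refine sumLT_congr fun i j _ => ?_
    rw [← sq, ← sq, ← neg_sub (z i) (z j), neg_sq, ← add_div]
  rw [h2]
  have hcancel : ∀ v : SpinSpace N twoM, mu p c z • E • v = v := fun v => by
    rw [smul_smul, hμE, one_smul]
  refine Eq.trans ?_ (hcancel _)
  module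

end Gauge

end SpinCS

end

theorem mainTheorem4 (N twoM : ℕ) (p : SpinCS.Params) :
    (∀ φ : SpinCS.SpinFun N twoM, SpinCS.IsAntisymm φ →
      ∀ z : SpinCS.Pt N, Function.Injective z → ContDiffAt ℝ 2 φ z →
        SpinCS.Hstar p φ z = SpinCS.Hbar p φ z) ∧
    (∀ (I : Fin N → Set ℝ) (c τ : Fin N → ℝ),
      (∀ i, IsOpen (I i)) → (∀ i, (I i).OrdConnected) → (∀ i, c i ∈ I i) →
      (∀ i, ∀ y ∈ I i, 0 < (SpinCS.P p).eval y) →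
        (∀ i, Set.InjOn (SpinCS.chi p (c i) (τ i)) (I i) ∧
          IsOpen (SpinCS.chi p (c i) (τ i) '' I i) ∧
          ContDiffOn ℝ ∞ (SpinCS.chi p (c i) (τ i)) (I i) ∧
          ContDiffOn ℝ ∞ (SpinCS.zeta p (I i) (c i) (τ i)) (SpinCS.chi p (c i) (τ i) '' I i)) ∧
        (∀ z ∈ SpinCS.zDom I, 0 < SpinCS.mu p c z) ∧
        ContDiffOn ℝ ∞ (SpinCS.mu p c) (SpinCS.zDom I) ∧
        (∀ x ∈ SpinCS.xDom p I c τ,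
          (SpinCS.potZ twoM p (SpinCS.zetaMap p I c τ x)).IsHermitian ∧
          ∀ ψ : SpinCS.SpinFun N twoM, ContDiffAt ℝ 2 ψ x →
            SpinCS.gaugeTransform (SpinCS.mu p c) (SpinCS.chiMap p c τ) (SpinCS.zetaMap p I c τ)
                (SpinCS.Hbar p) ψ x =
              SpinCS.schrodinger
                (fun x => SpinCS.potZ twoM p (SpinCS.zetaMap p I c τ x)) ψ x)) := by
  refine ⟨fun φ hφ z hz hd => hφ.Hstar_eq_Hbar p hz hd, fun I c τ hI hIc hc hP => ?_⟩
  have hinj : ∀ i, Set.InjOn (SpinCS.chi p (c i) (τ i)) (I i) := fun i =>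
    SpinCS.injOn_chi (hI i) (hIc i) (hc i) (hP i)
  refine ⟨fun i => ⟨hinj i,
    SpinCS.isOpen_image_chi (hI i) (hIc i) (hc i) (hP i) (hI i) subset_rfl,
    SpinCS.contDiffOn_chi (hI i) (hIc i) (hc i) (hP i),
    SpinCS.contDiffOn_zeta (hI i) (hIc i) (hc i) (hP i)⟩, fun z hz => ?_, ?_, ?_⟩
  · rw [SpinCS.mu_eq_exp hP hz]
    exact Real.exp_pos _
  · exact (SpinCS.contDiffOn_gaugeLog hI hIc hc hP).exp.congr fun z hz => SpinCS.mu_eq_exp hP hz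
  · rintro _ ⟨z, hz, rfl⟩
    have hzeta : SpinCS.zetaMap p I c τ (SpinCS.chiMap p c τ z) = z :=
      funext fun i => (hinj i).leftInvOn_invFunOn (hz.1 i)
    refine ⟨SpinCS.potZ_isHermitian p _, fun ψ hψ => ?_⟩
    rw [SpinCS.gaugeTransform, SpinCS.schrodinger, hzeta]
    exact SpinCS.gaugeTransform_Hbar hI hIc hc hP hz hψ
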